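/- \textbf{Rank bound.} Let $\alpha,\beta\in(0,1)$ and let $L\subseteq[-1,-\beta]\cup\{\alpha\}$ with $\alpha\in L$. A (spherical) $L$-code in $\mathbb{R}^d$ is a finite set of unit vectors in $\mathbb{R}^d$ whose pairwise inner products (of distinct vectors) lie in $L$. The negative graph of an $L$-code $C$ is the simple graph on $C$ in which distinct $u,v$ are adjacent if and only if $\langle u,v\rangle<0$. An $L$-code $C$ with Gram matrix $M_C$ is called $\alpha$-singular if $M_C-\alpha J$ is a singular positive semidefinite matrix, where $J$ is the all-ones matrix. For every integer $\Delta\ge 0$ there is a constant $K=K(L,\Delta)$ such that the following holds for every $d$. Let $V$ be an $L$-code in $\mathbb{R}^d$ whose negative graph has maximum degree at most $\Delta$, and suppose that exactly $r$ of the connected components of its negative graph have an $\alpha$-singular vertex set. Then \[ |V|\le d+r-1 \quad\text{if } r\neq 0, \qquad\text{and}\qquad |V|\le d+K\,\frac{d}{\log\log d}\quad\text{if } r=0 \text{ and } d\ge 3. \] -/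

import Mathlib

/-- `C` is a spherical `L`-code in `ℝ^d`: a finite set of unit vectors whose pairwise inner
products lie in `L`. -/
def IsSphericalCode (L : Set ℝ) {d : ℕ} (C : Finset (EuclideanSpace ℝ (Fin d))) : Prop :=
  (∀ v ∈ C, ‖v‖ = 1) ∧ ∀ u ∈ C, ∀ v ∈ C, u ≠ v → inner ℝ u v ∈ L

/-- The negative graph of `C`: vertex set `C`, with distinct `u`, `v` adjacent iff `⟨u, v⟩ < 0`. -/
def negGraph {d : ℕ} (C : Finset (EuclideanSpace ℝ (Fin d))) : SimpleGraph C where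
  Adj u v := u ≠ v ∧ inner ℝ (u : EuclideanSpace ℝ (Fin d)) v < 0
  symm := ⟨fun u v h => ⟨h.1.symm, by rw [real_inner_comm]; exact h.2⟩⟩
  loopless := ⟨fun _ h => h.1 rfl⟩

open Classical in
/-- The maximum negative degree of `C`, i.e. the maximum degree of its negative graph. -/
noncomputable def maxNegDegree {d : ℕ} (C : Finset (EuclideanSpace ℝ (Fin d))) : ℕ :=
  (negGraph C).maxDegree

/-- The matrix `M_C - α J`, where `M_C` is the Gram matrix of `C` and `J` is the all-ones matrix. -/
noncomputable def shiftedGram (α : ℝ) {d : ℕ} (C : Finset (EuclideanSpace ℝ (Fin d))) :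
    Matrix C C ℝ :=
  Matrix.gram ℝ (fun v : C => (v : EuclideanSpace ℝ (Fin d))) - α • Matrix.of fun _ _ => (1 : ℝ)

open Classical in
/-- `C` is an `α`-singular `L`-code: a spherical `L`-code for which `M_C - α J` is a singular
positive semidefinite matrix. -/
def IsAlphaSingular (L : Set ℝ) (α : ℝ) {d : ℕ} (C : Finset (EuclideanSpace ℝ (Fin d))) : Prop :=
  IsSphericalCode L C ∧ (shiftedGram α C).PosSemidef ∧ (shiftedGram α C).det = 0

open Classical in
/-- The set of vectors of `C` forming the connected component `K` of the negative graph of `C`. -/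
noncomputable def componentVectors {d : ℕ} (C : Finset (EuclideanSpace ℝ (Fin d)))
    (K : (negGraph C).ConnectedComponent) : Finset (EuclideanSpace ℝ (Fin d)) :=
  {v ∈ C | ∃ h : v ∈ C, (negGraph C).connectedComponentMk ⟨v, h⟩ = K}

/-- The number of connected components of the negative graph of `C` that are `α`-singular. -/
noncomputable def numSingularComponents (L : Set ℝ) (α : ℝ) {d : ℕ}
    (C : Finset (EuclideanSpace ℝ (Fin d))) : ℕ :=
  {K : (negGraph C).ConnectedComponent | IsAlphaSingular L α (componentVectors C K)}.ncard

/-! ### Dimension counts, a Frobenius norm bound, and nets in connected graphs -/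

section Spectral

open scoped Matrix
-- Put `lam = 1 - α` and let `A = lam I - (M_C - αJ)`. Pairs with inner product `α` contribute `0`
-- to `A`, so `A` is a weighted adjacency matrix of the negative graph, with weights bounded below.
-- If `T` sends coefficients to combinations of code vectors, then `‖T x‖² = lam |x|² - xᵀA x + α(∑
-- x)²` and `|V| ≤ d + dim ker T`, so the task is to bound `ker T`. On sum-zero vectors `xᵀA x ≤ lam
-- |x|²`. Two separated vectors exceeding `lam` have a sum-zero combination violating this, so at
-- most one component is not dominated by `lam` (`false_of_separated`).
--
-- If some component is singular, the same argument shows that all components are dominated. Then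
-- `ker T` lies in the `lam`-eigenspace of `A`, which has dimension at most `r` by Perron-Frobenius.
-- The inclusion is strict, because a nonnegative eigenvector has positive sum; this gives the `-1`.
--
-- If no component is singular and all are dominated, `ker T = 0`. Otherwise the sum-zero part of
-- `ker T` consists of `lam`-eigenvectors supported on the one exceptional component, where `lam` is
-- at least the second eigenvalue. `finrank_eigenSubmodule_le` bounds its multiplicity sublinearly.
-- Delete a net together with the few vertices near which the form exceeds `lam`. Eigenvectors
-- vanishing there survive the deletion, while each block of steps of the deleted matrix `B`,
-- started at any vertex, loses a definite factor against `lam`. The Frobenius norm of a power of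
-- `B` then bounds the dimension, and optimising the parameters gives `d / log log d`.
theorem finrank_le_add_finrank_inf_ker {M W : Type*} [AddCommGroup M] [Module ℝ M]
    [FiniteDimensional ℝ M] [AddCommGroup W] [Module ℝ W] [FiniteDimensional ℝ W]
    (E : Submodule ℝ M) (f : M →ₗ[ℝ] W) :
    Module.finrank ℝ E ≤ Module.finrank ℝ W + Module.finrank ℝ ↥(E ⊓ LinearMap.ker f) := by
  have h := LinearMap.finrank_range_add_finrank_ker (f.domRestrict E)
  have h1 : Module.finrank ℝ (LinearMap.range (f.domRestrict E)) ≤ Module.finrank ℝ W :=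
    Submodule.finrank_le _
  have h2 : Module.finrank ℝ (LinearMap.ker (f.domRestrict E)) ≤
      Module.finrank ℝ ↥(E ⊓ LinearMap.ker f) := by
    let g : LinearMap.ker (f.domRestrict E) →ₗ[ℝ] ↥(E ⊓ LinearMap.ker f) :=
      LinearMap.codRestrict _ (E.subtype ∘ₗ (LinearMap.ker (f.domRestrict E)).subtype)
        (fun x => ⟨x.1.2, x.2⟩)
    refine LinearMap.finrank_le_finrank_of_injective (f := g) ?_
    intro x y hxy
    have := congrArg Subtype.val hxy
    exact Subtype.ext (Subtype.ext this)
  omega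

theorem finrank_le_of_forall_eq_zero {M W : Type*} [AddCommGroup M] [Module ℝ M]
    [FiniteDimensional ℝ M] [AddCommGroup W] [Module ℝ W] [FiniteDimensional ℝ W]
    (E : Submodule ℝ M) (f : M →ₗ[ℝ] W) (h : ∀ x ∈ E, f x = 0 → x = 0) :
    Module.finrank ℝ E ≤ Module.finrank ℝ W := by
  have h1 := finrank_le_add_finrank_inf_ker E f
  have h2 : E ⊓ LinearMap.ker f = ⊥ := by
    rw [eq_bot_iff]
    rintro x ⟨hx, hx'⟩
    exact h x hx hx'
  rw [h2, finrank_bot] at h1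
  simpa using h1

/-- For an orthonormal basis `b i` of `E`, symmetry of `P` makes the inner product of `b i` with
column `v` equal to `c * b i v`. Bessel's inequality for each column, summed over the columns, gives
the bound. -/
theorem finrank_mul_sq_le_sum_sq {V : Type*} [Fintype V] [DecidableEq V] (P : Matrix V V ℝ) (hP : P.IsSymm) (c : ℝ)
    (E : Submodule ℝ (V → ℝ)) (hE : ∀ x ∈ E, P *ᵥ x = c • x) :
    (Module.finrank ℝ E : ℝ) * c ^ 2 ≤ ∑ v, ∑ u, P u v ^ 2 := by
  let e := (WithLp.linearEquiv 2 ℝ (V → ℝ)).symm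
  let F : Submodule ℝ (EuclideanSpace ℝ V) := E.map e.toLinearMap
  have hF : Module.finrank ℝ F = Module.finrank ℝ E := LinearEquiv.finrank_map_eq e E
  let b := stdOrthonormalBasis ℝ F
  have hb : Orthonormal ℝ (fun i => (b i : EuclideanSpace ℝ V)) :=
    b.orthonormal.comp_linearIsometry F.subtypeₗᵢ
  have hbP : ∀ i v, ∑ u, P u v * (b i : EuclideanSpace ℝ V) u
      = c * (b i : EuclideanSpace ℝ V) v := by
    intro i v
    obtain ⟨x, hx, hxe⟩ := (Submodule.mem_map.mp (b i).2)
    have h1 := congrFun (hE x hx) v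
    rw [← hxe]
    simp only [Matrix.mulVec, dotProduct, Pi.smul_apply, smul_eq_mul] at h1
    have : ∀ u, (e.toLinearMap x) u = x u := fun u => rfl
    simp only [this]
    rw [← h1]
    refine Finset.sum_congr rfl fun u _ => ?_
    rw [hP.apply]
  have bessel : ∀ v, ∑ i, (c * (b i : EuclideanSpace ℝ V) v) ^ 2 ≤ ∑ u, P u v ^ 2 := by
    intro v
    have h := hb.sum_inner_products_le (s := Finset.univ)
      (WithLp.toLp 2 (fun u => P u v) : EuclideanSpace ℝ V)
    rw [EuclideanSpace.norm_sq_eq] at h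
    simp only [Real.norm_eq_abs, sq_abs] at h
    refine le_trans (le_of_eq ?_) h
    refine Finset.sum_congr rfl fun i _ => ?_
    rw [← hbP i v]
    simp [PiLp.inner_apply]
  have h1 : ∀ i, ∑ v, (b i : EuclideanSpace ℝ V) v ^ 2 = 1 := by
    intro i
    have := hb.1 i
    have h2 : ‖(b i : EuclideanSpace ℝ V)‖ ^ 2 = 1 := by rw [this]; norm_num
    rw [EuclideanSpace.norm_sq_eq] at h2
    simpa using h2
  calc (Module.finrank ℝ E : ℝ) * c ^ 2
      = ∑ i : Fin (Module.finrank ℝ F), ∑ v, (c * (b i : EuclideanSpace ℝ V) v) ^ 2 := by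
        simp only [mul_pow, ← Finset.mul_sum, h1]
        simp [hF, mul_comm]
    _ = ∑ v, ∑ i, (c * (b i : EuclideanSpace ℝ V) v) ^ 2 := Finset.sum_comm
    _ ≤ _ := Finset.sum_le_sum fun v _ => bessel v

/-! ### Distances in connected graphs -/

theorem SimpleGraph.Connected.exists_adj_dist_eq {V : Type*} {G : SimpleGraph V} (hG : G.Connected) {v u : V}
    {k : ℕ} (h : G.dist v u = k + 1) : ∃ x, G.Adj u x ∧ G.dist v x = k := by
  obtain ⟨p, hp⟩ := hG.exists_walk_length_eq_dist u v
  rw [SimpleGraph.dist_comm] at h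
  cases p with
  | nil => simp at h
  | @cons _ x _ hx q =>
    refine ⟨x, hx, ?_⟩
    have h1 : G.dist x v ≤ q.length := SimpleGraph.dist_le q
    have h2 : G.dist u v ≤ G.dist u x + G.dist x v := hG.dist_triangle
    have h3 : G.dist u x = 1 := SimpleGraph.dist_eq_one_iff_adj.mpr hx
    simp only [SimpleGraph.Walk.length_cons] at hp
    rw [SimpleGraph.dist_comm]
    omega

theorem SimpleGraph.Connected.dist_le_succ_of_adj {V : Type*} {G : SimpleGraph V} (hG : G.Connected)
    {v u x : V} {k : ℕ} (h : G.dist v u ≤ k) (hx : G.Adj u x) : G.dist v x ≤ k + 1 := by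
  have h2 : G.dist v x ≤ G.dist v u + G.dist u x := hG.dist_triangle
  have h3 : G.dist u x = 1 := SimpleGraph.dist_eq_one_iff_adj.mpr hx
  omega

open Classical in
theorem SimpleGraph.Connected.card_dist_le {V : Type*} [Fintype V] {G : SimpleGraph V} (hG : G.Connected) {Δ : ℕ}
    (hΔ : ∀ v, {u | G.Adj v u}.ncard ≤ Δ) (v : V) (k : ℕ) :
    (Finset.univ.filter fun u => G.dist v u ≤ k).card ≤ (Δ + 1) ^ k := by
  induction k with
  | zero =>
    rw [pow_zero, Finset.card_le_one]
    intro a ha b hb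
    simp only [Finset.mem_filter, Finset.mem_univ, true_and, nonpos_iff_eq_zero,
      hG.dist_eq_zero_iff] at ha hb
    rw [← ha, ← hb]
  | succ k ih =>
    have hsub : (Finset.univ.filter fun u => G.dist v u ≤ k + 1) ⊆
        (Finset.univ.filter fun u => G.dist v u ≤ k).biUnion
          (fun x => insert x (Finset.univ.filter (G.Adj x))) := by
      intro u hu
      simp only [Finset.mem_filter, Finset.mem_univ, true_and, Finset.mem_biUnion,
        Finset.mem_insert] at hu ⊢
      rcases Nat.lt_or_ge (G.dist v u) (k + 1) with h | h
      · exact ⟨u, by omega, Or.inl rfl⟩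
      · obtain ⟨x, hx, hd⟩ := hG.exists_adj_dist_eq (le_antisymm hu h)
        exact ⟨x, hd.le, Or.inr hx.symm⟩
    refine (Finset.card_le_card hsub).trans ?_
    refine (Finset.card_biUnion_le_card_mul _ _ (Δ + 1) ?_).trans ?_
    · intro x _
      refine (Finset.card_insert_le _ _).trans ?_
      have := hΔ x
      rw [Set.ncard_eq_toFinset_card'] at this
      have h2 : (Finset.univ.filter (G.Adj x)) = {u | G.Adj x u}.toFinset := by ext; simp
      rw [h2]; omega
    · rw [pow_succ]; exact Nat.mul_le_mul_right _ ih

theorem SimpleGraph.Connected.exists_dist_eq {V : Type*} {G : SimpleGraph V} (hG : G.Connected) {v u : V}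
    {i : ℕ} (h : i ≤ G.dist v u) : ∃ x, G.dist v x = i := by
  obtain ⟨t, ht⟩ := Nat.exists_eq_add_of_le h
  induction t generalizing u with
  | zero => exact ⟨u, ht⟩
  | succ t ih =>
    obtain ⟨x, -, hx⟩ := hG.exists_adj_dist_eq (v := v) (u := u) (k := i + t) ht
    exact ih (by omega) hx

open Classical in
/-- A connected graph on `n` vertices has a `2j`-net of size at most `n / (j + 1) + 1`. -/
theorem SimpleGraph.Connected.exists_net {V : Type*} [Fintype V] {G : SimpleGraph V} (hG : G.Connected) (j : ℕ) :
    ∃ S : Finset V, (∀ u, ∃ s ∈ S, G.dist u s ≤ 2 * j) ∧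
      (S.card : ℝ) ≤ Fintype.card V / (j + 1) + 1 := by
  -- A largest set with pairwise distances above `2j` is a net, since otherwise a point could be
  -- added.
  let good : Finset (Finset V) :=
    Finset.univ.filter fun S => ∀ a ∈ S, ∀ b ∈ S, a ≠ b → 2 * j < G.dist a b
  obtain ⟨S, hS, hmax⟩ := Finset.exists_max_image good Finset.card ⟨∅, by simp [good]⟩
  simp only [good, Finset.mem_filter, Finset.mem_univ, true_and] at hS hmax
  refine ⟨S, ?_, ?_⟩
  · intro u
    by_contra! hu
    have huS : u ∉ S := fun h => by simpa using hu u h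
    have := hmax (insert u S) (by
      intro a ha b hb hab
      rw [Finset.mem_insert] at ha hb
      rcases ha with rfl | ha <;> rcases hb with rfl | hb
      · exact absurd rfl hab
      · exact hu b hb
      · rw [SimpleGraph.dist_comm]; exact hu a ha
      · exact hS a ha b hb hab)
    rw [Finset.card_insert_of_notMem huS] at this
    omega
  · rcases Nat.lt_or_ge 1 S.card with h1 | h1
    -- A second net point lies beyond distance `2j`, so by connectedness every distance `0, …, j`
    -- from `s` occurs. The balls of radius `j` are disjoint.
    · have hball : ∀ s ∈ S, j + 1 ≤ (Finset.univ.filter fun u => G.dist s u ≤ j).card := by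
        intro s hs
        obtain ⟨t, ht, hts⟩ := Finset.exists_mem_ne h1 s
        have hd := hS s hs t ht hts.symm
        have : Finset.range (j + 1) ⊆
            (Finset.univ.filter fun u => G.dist s u ≤ j).image (G.dist s) := by
          intro i hi
          rw [Finset.mem_range] at hi
          obtain ⟨x, hx⟩ := hG.exists_dist_eq (v := s) (u := t) (i := i) (by omega)
          rw [Finset.mem_image]
          exact ⟨x, by simp; omega, hx⟩
        have h2 := (Finset.card_le_card this).trans Finset.card_image_le
        simpa using h2
      have hdisj : (S : Set V).PairwiseDisjoint
          (fun s => Finset.univ.filter fun u => G.dist s u ≤ j) := by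
        intro a ha b hb hab
        rw [Function.onFun, Finset.disjoint_left]
        intro x hxa hxb
        simp only [Finset.mem_filter, Finset.mem_univ, true_and] at hxa hxb
        have h3 := hS a ha b hb hab
        have h4 : G.dist a b ≤ G.dist a x + G.dist x b := hG.dist_triangle
        rw [SimpleGraph.dist_comm (u := x)] at h4
        omega
      have h5 : S.card * (j + 1) ≤ Fintype.card V := by
        calc S.card * (j + 1) = ∑ s ∈ S, (j + 1) := by simp
          _ ≤ ∑ s ∈ S, (Finset.univ.filter fun u => G.dist s u ≤ j).card :=
            Finset.sum_le_sum hball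
          _ = (S.biUnion fun s => Finset.univ.filter fun u => G.dist s u ≤ j).card :=
            (Finset.card_biUnion hdisj).symm
          _ ≤ _ := Finset.card_le_univ _
      have h6 : (S.card : ℝ) ≤ Fintype.card V / (j + 1) := by
        rw [le_div_iff₀ (by positivity)]
        exact_mod_cast h5
      linarith
    · have : (S.card : ℝ) ≤ 1 := by exact_mod_cast h1
      have h7 : (0 : ℝ) ≤ Fintype.card V / (j + 1) := by positivity
      linarith

end Spectral

/-! ### Weighted adjacency matrices and the effect of deleting a net -/

section WeightedAdjacency

open scoped Matrix

/-- `A` is a symmetric matrix supported on the edges of `G`, with all weights at least `w > 0`. -/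
structure IsWeightedAdjacency {V : Type*} (G : SimpleGraph V) (A : Matrix V V ℝ) (w : ℝ) :
    Prop where
  isSymm : A.IsSymm
  pos : 0 < w
  le_of_adj : ∀ {u v}, G.Adj u v → w ≤ A u v
  eq_zero : ∀ {u v}, ¬ G.Adj u v → A u v = 0

variable {V : Type*} {G : SimpleGraph V} {A : Matrix V V ℝ} {w lam : ℝ}

theorem IsWeightedAdjacency.nonneg (h : IsWeightedAdjacency G A w) (u v : V) : 0 ≤ A u v := by
  by_cases huv : G.Adj u v
  · exact h.pos.le.trans (h.le_of_adj huv)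
  · exact (h.eq_zero huv).ge

theorem IsWeightedAdjacency.adj_of_ne_zero (h : IsWeightedAdjacency G A w) {u v : V}
    (huv : A u v ≠ 0) : G.Adj u v := by
  by_contra hn
  exact huv (h.eq_zero hn)

/-- The matrix `A` with the rows and columns in `S` replaced by zero. -/
noncomputable def Matrix.deleteSet (A : Matrix V V ℝ) (S : Set V) : Matrix V V ℝ :=
  open Classical in Matrix.of fun u v => if u ∈ S ∨ v ∈ S then 0 else A u v

theorem Matrix.deleteSet_isSymm (hA : A.IsSymm) (S : Set V) : (A.deleteSet S).IsSymm := by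
  refine Matrix.IsSymm.ext fun u v => ?_
  by_cases hu : u ∈ S <;> by_cases hv : v ∈ S <;>
    simp [Matrix.deleteSet, hu, hv, hA.apply u v]

theorem IsWeightedAdjacency.deleteSet_nonneg (h : IsWeightedAdjacency G A w) (S : Set V)
    (u v : V) : 0 ≤ A.deleteSet S u v := by
  simp only [Matrix.deleteSet, Matrix.of_apply]
  split_ifs
  exacts [le_rfl, h.nonneg u v]

theorem IsWeightedAdjacency.deleteSet_le (h : IsWeightedAdjacency G A w) (S : Set V)
    (u v : V) : A.deleteSet S u v ≤ A u v := by
  simp only [Matrix.deleteSet, Matrix.of_apply]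
  split_ifs
  exacts [h.nonneg u v, le_rfl]

theorem Matrix.deleteSet_apply_of_mem {S : Set V} {u v : V} (huv : u ∈ S ∨ v ∈ S) :
    A.deleteSet S u v = 0 := by
  simp [Matrix.deleteSet, huv]

variable [Fintype V]

theorem Matrix.IsSymm.dotProduct_mulVec_comm (hA : A.IsSymm) (x y : V → ℝ) :
    x ⬝ᵥ A *ᵥ y = y ⬝ᵥ A *ᵥ x := by
  rw [Matrix.dotProduct_mulVec, ← Matrix.mulVec_transpose, hA.eq, dotProduct_comm]

theorem IsWeightedAdjacency.dotProduct_mulVec_le_abs (h : IsWeightedAdjacency G A w)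
    (x y : V → ℝ) : x ⬝ᵥ A *ᵥ y ≤ |x| ⬝ᵥ A *ᵥ |y| := by
  simp only [dotProduct, Matrix.mulVec, Finset.mul_sum]
  refine Finset.sum_le_sum fun u _ => Finset.sum_le_sum fun v _ => ?_
  have h1 := h.nonneg u v
  have h2 : x u * y v ≤ |x u| * |y v| := by rw [← abs_mul]; exact le_abs_self _
  calc x u * (A u v * y v) = A u v * (x u * y v) := by ring
    _ ≤ A u v * (|x u| * |y v|) := by gcongr
    _ = |x| u * (A u v * |y| v) := by simp only [Pi.abs_apply]; ring

theorem dotProduct_abs_self (x : V → ℝ) : |x| ⬝ᵥ |x| = x ⬝ᵥ x := by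
  simp [dotProduct]

/-- A bound on the quadratic form on vectors supported in `s` bounds the operator norm. -/
theorem IsWeightedAdjacency.mulVec_sq_le (h : IsWeightedAdjacency G A w) (hlam : 0 < lam)
    {s : Set V} (hs : ∀ z : V → ℝ, (∀ v, v ∉ s → z v = 0) → z ⬝ᵥ A *ᵥ z ≤ lam * (z ⬝ᵥ z))
    {y : V → ℝ} (hy : ∀ v, v ∉ s → y v = 0) (hAy : ∀ v, v ∉ s → (A *ᵥ y) v = 0) :
    (A *ᵥ y) ⬝ᵥ (A *ᵥ y) ≤ lam ^ 2 * (y ⬝ᵥ y) := by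
  have hneg : ∀ z : V → ℝ, (∀ v, v ∉ s → z v = 0) → -(lam * (z ⬝ᵥ z)) ≤ z ⬝ᵥ A *ᵥ z := by
    intro z hz
    have h1 := h.dotProduct_mulVec_le_abs (-z) z
    have h2 := hs |z| (fun v hv => by simp [hz v hv])
    rw [dotProduct_abs_self] at h2
    rw [abs_neg, neg_dotProduct] at h1
    linarith
  set b := A *ᵥ y with hb
  -- Combining the upper bound at `lam y + b` with the lower bound at `lam y - b` cancels the terms
  -- `y ⬝ᵥ b` and `b ⬝ᵥ A *ᵥ b`.
  have h1 := hs (lam • y + b) (fun v hv => by simp [hy v hv, hAy v hv])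
  have h2 := hneg (lam • y - b) (fun v hv => by simp [hy v hv, hAy v hv])
  have h3 := h.isSymm.dotProduct_mulVec_comm b y
  have h4 : y ⬝ᵥ A *ᵥ b = b ⬝ᵥ b := by rw [← h3]
  simp only [Matrix.mulVec_add, Matrix.mulVec_sub, add_dotProduct, dotProduct_add,
    sub_dotProduct, dotProduct_sub, Matrix.mulVec_smul, smul_dotProduct, dotProduct_smul,
    smul_eq_mul, h4, ← hb, dotProduct_comm b y] at h1 h2
  have h5 : lam * (b ⬝ᵥ b) ≤ lam * (lam ^ 2 * (y ⬝ᵥ y)) := by nlinarith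
  exact le_of_mul_le_mul_left h5 hlam

/-- If the quadratic form of `A` is at most `lam` on vectors of sum zero, then there are no two
separated vectors on which it exceeds `lam`. -/
theorem IsWeightedAdjacency.false_of_separated (h : IsWeightedAdjacency G A w)
    (hsum : ∀ x : V → ℝ, ∑ v, x v = 0 → x ⬝ᵥ A *ᵥ x ≤ lam * (x ⬝ᵥ x)) {y z : V → ℝ}
    (hyz : ∀ u v, y u ≠ 0 → z v ≠ 0 → u ≠ v ∧ ¬ G.Adj u v)
    (hy : lam * (y ⬝ᵥ y) < y ⬝ᵥ A *ᵥ y) (hz : lam * (z ⬝ᵥ z) ≤ z ⬝ᵥ A *ᵥ z) (hz0 : z ≠ 0) :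
    False := by
  have h1 := h.dotProduct_mulVec_le_abs y y
  have h2 := h.dotProduct_mulVec_le_abs z z
  rw [← dotProduct_abs_self] at hy hz
  set σ := ∑ v, |y| v
  set τ := ∑ v, |z| v with hτ
  have hτ0 : 0 < τ := by
    obtain ⟨v, hv⟩ := Function.ne_iff.mp hz0
    exact Finset.sum_pos' (fun v _ => abs_nonneg (z v)) ⟨v, Finset.mem_univ _, abs_pos.mpr hv⟩
  -- This combination has sum zero, and separation kills its cross terms. Absolute values only
  -- increase the form and ensure `τ > 0`.
  have h3 := hsum (τ • |y| - σ • |z|) (by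
    simp only [Pi.sub_apply, Pi.smul_apply, smul_eq_mul, Finset.sum_sub_distrib, ← Finset.mul_sum]
    ring)
  have h4 : |y| ⬝ᵥ |z| = 0 := by
    refine Finset.sum_eq_zero fun v _ => ?_
    by_cases hv : y v = 0
    · simp [hv]
    · by_cases hv' : z v = 0
      · simp [hv']
      · exact absurd rfl (hyz v v hv hv').1
  have h5 : |y| ⬝ᵥ A *ᵥ |z| = 0 := by
    simp only [dotProduct, Matrix.mulVec, Finset.mul_sum]
    refine Finset.sum_eq_zero fun u _ => Finset.sum_eq_zero fun v _ => ?_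
    by_cases hu : y u = 0
    · simp [hu]
    · by_cases hv' : z v = 0
      · simp [hv']
      · simp [h.eq_zero (hyz u v hu hv').2]
  have h6 := h.isSymm.dotProduct_mulVec_comm |z| |y|
  rw [h5] at h6
  have h7 : |z| ⬝ᵥ |y| = 0 := by rw [dotProduct_comm, h4]
  simp only [Matrix.mulVec_sub, sub_dotProduct, dotProduct_sub, Matrix.mulVec_smul,
    smul_dotProduct, dotProduct_smul, smul_eq_mul, h4, h5, h6, h7] at h3
  have h8 : 0 < τ * τ * (|y| ⬝ᵥ A *ᵥ |y| - lam * (|y| ⬝ᵥ |y|)) :=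
    mul_pos (mul_pos hτ0 hτ0) (by linarith)
  have h9 : 0 ≤ σ * σ * (|z| ⬝ᵥ A *ᵥ |z| - lam * (|z| ⬝ᵥ |z|)) :=
    mul_nonneg (mul_self_nonneg _) (by linarith)
  nlinarith

theorem Matrix.pow_apply_nonneg_and_le [DecidableEq V] {A B : Matrix V V ℝ}
    (hB : ∀ u v, 0 ≤ B u v) (hBA : ∀ u v, B u v ≤ A u v) (k : ℕ) :
    ∀ u v, 0 ≤ (B ^ k) u v ∧ (B ^ k) u v ≤ (A ^ k) u v := by
  induction k with
  | zero =>
    intro u v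
    simp only [pow_zero, le_refl, and_true, Matrix.one_apply]
    split_ifs <;> norm_num
  | succ k ih =>
    intro u v
    rw [pow_succ, pow_succ, Matrix.mul_apply, Matrix.mul_apply]
    exact ⟨Finset.sum_nonneg fun x _ => mul_nonneg (ih u x).1 (hB x v),
      Finset.sum_le_sum fun x _ => mul_le_mul (ih u x).2 (hBA x v) (hB x v)
        ((ih u x).1.trans (ih u x).2)⟩

/-- Deleting a net strictly decreases some entry in every row of a power. -/
theorem IsWeightedAdjacency.exists_deleteSet_pow_add_le [DecidableEq V]
    (h : IsWeightedAdjacency G A w) (hG : G.Connected) (hnbr : ∀ u, ∃ x, G.Adj u x) (S : Set V)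
    (r : ℕ) (u : V) (hu : ∃ s ∈ S, G.dist s u ≤ r + 1) :
    ∃ v, (A.deleteSet S ^ (r + 1)) u v + w ^ (r + 1) ≤ (A ^ (r + 1)) u v := by
  -- One step of a walk towards the net. From a vertex of `S` the walk must leave to distance `1`,
  -- hence `max 1 k`. The final edge touches `S`, so the whole walk is lost in the deleted matrix;
  -- it has weight at least `w ^ (r + 1)`.
  have key : ∀ k (u : V), (∃ s ∈ S, G.dist s u ≤ k + 1) →
      ∃ x, G.Adj u x ∧ (∃ s ∈ S, G.dist s x ≤ max 1 k) ∧ (k = 0 → u ∈ S ∨ x ∈ S) := by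
    rintro k u ⟨s, hs, hd⟩
    rcases Nat.eq_zero_or_pos (G.dist s u) with h0 | h0
    · obtain rfl := hG.dist_eq_zero_iff.mp h0
      obtain ⟨x, hx⟩ := hnbr s
      exact ⟨x, hx, ⟨s, hs, by rw [SimpleGraph.dist_eq_one_iff_adj.mpr hx]; exact le_max_left _ _⟩,
        fun _ => Or.inl hs⟩
    · obtain ⟨i, hi⟩ : ∃ i, G.dist s u = i + 1 := ⟨G.dist s u - 1, by omega⟩
      obtain ⟨x, hx, hxd⟩ := hG.exists_adj_dist_eq hi
      refine ⟨x, hx, ⟨s, hs, by rw [hxd]; exact le_max_of_le_right (by omega)⟩, fun hk => ?_⟩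
      have : G.dist s x = 0 := by omega
      rw [← hG.dist_eq_zero_iff.mp this]
      exact Or.inr hs
  induction r generalizing u with
  | zero =>
    obtain ⟨x, hx, -, hS⟩ := key 0 u hu
    refine ⟨x, ?_⟩
    simp only [zero_add, pow_one, Matrix.deleteSet_apply_of_mem (hS rfl)]
    exact h.le_of_adj hx
  | succ r ih =>
    obtain ⟨x, hx, ⟨s, hs, hd⟩, -⟩ := key (r + 1) u hu
    obtain ⟨v, hv⟩ := ih x ⟨s, hs, hd.trans (by simp)⟩
    refine ⟨v, ?_⟩
    rw [pow_succ' (A.deleteSet S), pow_succ' A, pow_succ' w, Matrix.mul_apply, Matrix.mul_apply]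
    have hpow := Matrix.pow_apply_nonneg_and_le (h.deleteSet_nonneg S) (h.deleteSet_le S) (r + 1)
    have h1 : ∀ y, A.deleteSet S u y * (A.deleteSet S ^ (r + 1)) y v
        + (if y = x then w * w ^ (r + 1) else 0) ≤ A u y * (A ^ (r + 1)) y v := by
      intro y
      have h2 : A.deleteSet S u y * (A.deleteSet S ^ (r + 1)) y v ≤
          A u y * (A.deleteSet S ^ (r + 1)) y v :=
        mul_le_mul_of_nonneg_right (h.deleteSet_le S u y) (hpow y v).1
      split_ifs with hyx
      · subst hyx
        have h3 : w * w ^ (r + 1) ≤ A u y * w ^ (r + 1) :=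
          mul_le_mul_of_nonneg_right (h.le_of_adj hx) (pow_nonneg h.pos.le _)
        have h4 := mul_le_mul_of_nonneg_left hv (h.nonneg u y)
        linarith
      · have := mul_le_mul_of_nonneg_left (hpow y v).2 (h.nonneg u y)
        linarith
    have h5 := Finset.sum_le_sum fun y (_ : y ∈ Finset.univ) => h1 y
    rw [Finset.sum_add_distrib, Finset.sum_ite_eq'] at h5
    simpa using h5

/-- With `Q` and `P` the powers of the deleted and the original matrix, `0 ≤ Q ≤ P` entrywise. Each
row has a gap of at least `c = w ^ (r + 1)` in some entry, so `P² - Q²` dominates `c² I` entrywise.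
This suffices against nonnegative vectors. -/
theorem IsWeightedAdjacency.deleteSet_pow_mulVec_sq_add_le [DecidableEq V]
    (h : IsWeightedAdjacency G A w) (hG : G.Connected) (hnbr : ∀ u, ∃ x, G.Adj u x) (S : Set V)
    (r : ℕ) (hS : ∀ u, ∃ s ∈ S, G.dist s u ≤ r + 1) (x : V → ℝ) (hx : ∀ v, 0 ≤ x v) :
    (A.deleteSet S ^ (r + 1) *ᵥ x) ⬝ᵥ (A.deleteSet S ^ (r + 1) *ᵥ x)
      + (w ^ (r + 1)) ^ 2 * (x ⬝ᵥ x) ≤ (A ^ (r + 1) *ᵥ x) ⬝ᵥ (A ^ (r + 1) *ᵥ x) := by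
  have hpow := Matrix.pow_apply_nonneg_and_le (h.deleteSet_nonneg S) (h.deleteSet_le S) (r + 1)
  have hgap := fun u => h.exists_deleteSet_pow_add_le hG hnbr S r u (hS u)
  have hQs : (A.deleteSet S ^ (r + 1)).IsSymm := (Matrix.deleteSet_isSymm h.isSymm S).pow _
  have hPs : (A ^ (r + 1)).IsSymm := h.isSymm.pow _
  set Q := A.deleteSet S ^ (r + 1)
  set P := A ^ (r + 1)
  set c := w ^ (r + 1)
  have hc : 0 ≤ c := pow_nonneg h.pos.le _
  have hquad : ∀ M : Matrix V V ℝ, M.IsSymm →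
      (M *ᵥ x) ⬝ᵥ (M *ᵥ x) = ∑ u, ∑ v, x u * ((∑ y, M u y * M v y) * x v) := by
    intro M hM
    rw [hM.dotProduct_mulVec_comm, Matrix.mulVec_mulVec]
    simp only [dotProduct, Matrix.mulVec, Finset.mul_sum, Matrix.mul_apply]
    refine Finset.sum_congr rfl fun u _ => Finset.sum_congr rfl fun v _ => ?_
    congr 2
    exact Finset.sum_congr rfl fun y _ => by rw [hM.apply v y]
  have hxx : c ^ 2 * (x ⬝ᵥ x) = ∑ u, ∑ v, if v = u then x u * (c ^ 2 * x v) else 0 := by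
    simp only [Finset.sum_ite_eq', Finset.mem_univ, if_true, dotProduct, Finset.mul_sum]
    exact Finset.sum_congr rfl fun u _ => by ring
  rw [hquad Q hQs, hquad P hPs, hxx, ← Finset.sum_add_distrib]
  refine Finset.sum_le_sum fun u _ => ?_
  rw [← Finset.sum_add_distrib]
  refine Finset.sum_le_sum fun v _ => ?_
  split_ifs with huv
  · subst huv
    rw [← mul_add, ← add_mul]
    refine mul_le_mul_of_nonneg_left (mul_le_mul_of_nonneg_right ?_ (hx v)) (hx v)
    obtain ⟨y₀, hy₀⟩ := hgap v
    have h1 : ∀ y, Q v y * Q v y + (if y = y₀ then c ^ 2 else 0) ≤ P v y * P v y := by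
      intro y
      have := hpow v y
      split_ifs with hy
      · subst hy
        nlinarith [mul_nonneg this.1 hc]
      · rw [add_zero]
        exact mul_self_le_mul_self this.1 this.2
    have h5 := Finset.sum_le_sum fun y (_ : y ∈ Finset.univ) => h1 y
    rw [Finset.sum_add_distrib, Finset.sum_ite_eq'] at h5
    simpa using h5
  · rw [add_zero]
    refine mul_le_mul_of_nonneg_left (mul_le_mul_of_nonneg_right ?_ (hx v)) (hx u)
    exact Finset.sum_le_sum fun y _ => mul_le_mul (hpow u y).2 (hpow v y).2 (hpow v y).1
      ((hpow u y).1.trans (hpow u y).2)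

end WeightedAdjacency

/-! ### Sublinear multiplicity of a second eigenvalue -/

section Multiplicity

open scoped Matrix

variable {V : Type*} [Fintype V] {G : SimpleGraph V} {A : Matrix V V ℝ} {w lam : ℝ}

/-- The eigenspace of `A` for the value `lam`, as a submodule of functions. -/
def Matrix.eigenSubmodule (A : Matrix V V ℝ) (lam : ℝ) : Submodule ℝ (V → ℝ) where
  carrier := {x | A *ᵥ x = lam • x}
  add_mem' {x y} hx hy := by
    simp only [Set.mem_ofPred_eq] at *
    rw [Matrix.mulVec_add, hx, hy, smul_add]
  zero_mem' := by simp
  smul_mem' c x hx := by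
    simp only [Set.mem_ofPred_eq] at *
    rw [Matrix.mulVec_smul, hx, smul_comm]

theorem Matrix.mem_eigenSubmodule {x : V → ℝ} :
    x ∈ A.eigenSubmodule lam ↔ A *ᵥ x = lam • x := Iff.rfl

theorem Matrix.pow_mulVec_eq_smul [DecidableEq V] {x : V → ℝ} (hx : A *ᵥ x = lam • x) (k : ℕ) :
    A ^ k *ᵥ x = lam ^ k • x := by
  induction k with
  | zero => simp
  | succ k ih =>
    rw [pow_succ', ← Matrix.mulVec_mulVec, ih, Matrix.mulVec_smul, hx, smul_smul, pow_succ]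

theorem Matrix.mulVec_apply_eq_zero {M : Matrix V V ℝ} {x : V → ℝ} {u : V}
    (h : ∀ v, M u v ≠ 0 → x v = 0) : (M *ᵥ x) u = 0 := by
  refine Finset.sum_eq_zero fun v _ => ?_
  by_cases hv : M u v = 0
  · simp [hv]
  · simp [h v hv]

theorem IsWeightedAdjacency.mulVec_eq_zero_of_dist (h : IsWeightedAdjacency G A w)
    (hG : G.Connected) {M : Matrix V V ℝ} (hM : ∀ u v, M u v ≠ 0 → A u v ≠ 0) {v : V} {i : ℕ}
    {x : V → ℝ} (hx : ∀ u, i < G.dist v u → x u = 0) {u : V} (hu : i + 1 < G.dist v u) :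
    (M *ᵥ x) u = 0 := by
  refine Matrix.mulVec_apply_eq_zero fun y hy => ?_
  refine hx y ?_
  by_contra! hd
  have := hG.dist_le_succ_of_adj hd (h.adj_of_ne_zero (hM u y hy)).symm
  omega

theorem IsWeightedAdjacency.pow_mulVec_eq_zero_of_dist [DecidableEq V]
    (h : IsWeightedAdjacency G A w)
    (hG : G.Connected) {M : Matrix V V ℝ} (hM : ∀ u v, M u v ≠ 0 → A u v ≠ 0) {v : V} {i : ℕ}
    {x : V → ℝ} (hx : ∀ u, i < G.dist v u → x u = 0) (k : ℕ) :
    ∀ u, i + k < G.dist v u → (M ^ k *ᵥ x) u = 0 := by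
  induction k with
  | zero => simpa using hx
  | succ k ih =>
    intro u hu
    rw [pow_succ', ← Matrix.mulVec_mulVec]
    exact h.mulVec_eq_zero_of_dist hG hM ih hu

theorem Matrix.mulVec_nonneg' {M : Matrix V V ℝ} (hM : ∀ u v, 0 ≤ M u v) {x : V → ℝ}
    (hx : ∀ v, 0 ≤ x v) (u : V) : 0 ≤ (M *ᵥ x) u :=
  Finset.sum_nonneg fun v _ => mul_nonneg (hM u v) (hx v)

/-- The vertices with a ball of radius `R` carrying a vector on which the quadratic form of `A`
exceeds `lam`. -/
def heavyCenters (G : SimpleGraph V) (A : Matrix V V ℝ) (lam : ℝ) (R : ℕ) : Set V :=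
  {v | ∃ z : V → ℝ, (∀ u, R < G.dist v u → z u = 0) ∧ lam * (z ⬝ᵥ z) < z ⬝ᵥ A *ᵥ z}

/-- Heavy centers at distance above `2R + 1` would have separated witnesses, so all of them lie in
one ball of radius `2R + 1`. -/
theorem IsWeightedAdjacency.ncard_heavyCenters_le (h : IsWeightedAdjacency G A w)
    (hG : G.Connected) {Δ : ℕ} (hΔ : ∀ v, {u | G.Adj v u}.ncard ≤ Δ)
    (hsum : ∀ x : V → ℝ, ∑ v, x v = 0 → x ⬝ᵥ A *ᵥ x ≤ lam * (x ⬝ᵥ x)) (R : ℕ) :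
    (heavyCenters G A lam R).ncard ≤ (Δ + 1) ^ (2 * R + 1) := by
  rcases (heavyCenters G A lam R).eq_empty_or_nonempty with he | ⟨v, hv⟩
  · simp [he]
  · classical
    refine le_trans ?_ (hG.card_dist_le hΔ v (2 * R + 1))
    rw [← Set.ncard_coe_finset]
    refine Set.ncard_le_ncard ?_ (Set.toFinite _)
    rintro u ⟨z, hz, hzq⟩
    obtain ⟨y, hy, hyq⟩ := hv
    simp only [Finset.coe_filter, Finset.mem_univ, true_and, Set.mem_ofPred_eq]
    by_contra! hd
    refine h.false_of_separated hsum (y := y) (z := z) ?_ hyq hzq.le ?_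
    · intro a b ha hb
      have ha' : G.dist v a ≤ R := by by_contra! hc; exact ha (hy a hc)
      have hb' : G.dist u b ≤ R := by by_contra! hc; exact hb (hz b hc)
      have h1 : G.dist v u ≤ G.dist v b + G.dist b u := hG.dist_triangle
      rw [SimpleGraph.dist_comm (u := b)] at h1
      refine ⟨?_, fun hab => ?_⟩
      · rintro rfl; omega
      · have := hG.dist_le_succ_of_adj ha' hab; omega
    · rintro rfl
      simp at hzq

/-- Around a vertex that is not heavy, `A` expands norms by at most `lam` as long as supports stay
in the ball. Each block of `r + 1` steps of the deleted matrix additionally loses the net term `(w ^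
(r + 1)) ^ 2`. -/
theorem IsWeightedAdjacency.deleteSet_pow_single_sq_le [DecidableEq V]
    (h : IsWeightedAdjacency G A w) (hlam : 0 < lam) (hw : w ≤ lam) (hG : G.Connected)
    (hnbr : ∀ u, ∃ x, G.Adj u x) (S : Set V) (r m : ℕ) (hS : ∀ u, ∃ s ∈ S, G.dist s u ≤ r + 1)
    {v : V} (hv : v ∉ heavyCenters G A lam ((r + 1) * m + 1)) (i : ℕ) (hi : i ≤ m) :
    (A.deleteSet S ^ ((r + 1) * i) *ᵥ Pi.single v 1) ⬝ᵥ
      (A.deleteSet S ^ ((r + 1) * i) *ᵥ Pi.single v 1) ≤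
      ((lam ^ (r + 1)) ^ 2 - (w ^ (r + 1)) ^ 2) ^ i := by
  have hBne : ∀ u v, A.deleteSet S u v ≠ 0 → A u v ≠ 0 := by
    intro u v h0 h1
    exact h0 (le_antisymm ((h.deleteSet_le S u v).trans h1.le) (h.deleteSet_nonneg S u v))
  -- `A *ᵥ y` spreads one step beyond `y`, which is why the heavy radius is `(r + 1) * m + 1`.
  have hgood : ∀ y : V → ℝ, (∀ u, (r + 1) * m < G.dist v u → y u = 0) →
      (A *ᵥ y) ⬝ᵥ (A *ᵥ y) ≤ lam ^ 2 * (y ⬝ᵥ y) := by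
    intro y hy
    refine h.mulVec_sq_le hlam (s := {u | G.dist v u ≤ (r + 1) * m + 1}) ?_ ?_ ?_
    · intro z hz
      by_contra! hc
      exact hv ⟨z, fun u hu => hz u (by simpa using hu), hc⟩
    · intro u hu
      exact hy u (by simp at hu; omega)
    · intro u hu
      exact h.mulVec_eq_zero_of_dist hG (fun _ _ h => h) hy (by simpa using hu)
  have hsupp : ∀ k u, k < G.dist v u → (A.deleteSet S ^ k *ᵥ Pi.single v 1) u = 0 := by
    intro k u hu
    refine h.pow_mulVec_eq_zero_of_dist hG hBne (v := v) (i := 0) ?_ k u (by omega)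
    intro u hu
    refine Pi.single_eq_of_ne ?_ _
    rintro rfl
    simp at hu
  have hApow : ∀ (i k : ℕ) (x : V → ℝ), i + k ≤ (r + 1) * m → (∀ u, i < G.dist v u → x u = 0) →
      (A ^ k *ᵥ x) ⬝ᵥ (A ^ k *ᵥ x) ≤ (lam ^ k) ^ 2 * (x ⬝ᵥ x) := by
    intro i k x hik hx
    induction k with
    | zero => simp
    | succ k ih =>
      rw [pow_succ' A, ← Matrix.mulVec_mulVec]
      refine (hgood _ fun u hu => ?_).trans ?_
      · exact h.pow_mulVec_eq_zero_of_dist hG (fun _ _ h => h) hx k u (by omega)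
      · calc _ ≤ lam ^ 2 * ((lam ^ k) ^ 2 * (x ⬝ᵥ x)) :=
              mul_le_mul_of_nonneg_left (ih (by omega)) (sq_nonneg _)
          _ = _ := by ring
  induction i with
  | zero =>
    rw [mul_zero, pow_zero, pow_zero, Matrix.one_mulVec]
    simp
  | succ i ih =>
    have ih := ih (by omega)
    set x := A.deleteSet S ^ ((r + 1) * i) *ᵥ Pi.single v 1 with hxdef
    have hx0 : ∀ u, 0 ≤ x u := by
      refine Matrix.mulVec_nonneg' (fun a b => (Matrix.pow_apply_nonneg_and_le
        (h.deleteSet_nonneg S) (h.deleteSet_le S) _ a b).1) fun u => ?_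
      rw [Pi.single_apply]
      split_ifs <;> norm_num
    have h1 := h.deleteSet_pow_mulVec_sq_add_le hG hnbr S r hS x hx0
    have h2 := hApow ((r + 1) * i) (r + 1) x
      (by calc (r + 1) * i + (r + 1) = (r + 1) * (i + 1) := by ring
            _ ≤ _ := Nat.mul_le_mul_left _ hi) (hsupp _)
    have h3 : A.deleteSet S ^ ((r + 1) * (i + 1)) *ᵥ Pi.single v 1
        = A.deleteSet S ^ (r + 1) *ᵥ x := by
      rw [hxdef, Matrix.mulVec_mulVec, ← pow_add]
      congr 2
      ring
    rw [h3]
    set ρ := (lam ^ (r + 1)) ^ 2 - (w ^ (r + 1)) ^ 2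
    have h4 : (A.deleteSet S ^ (r + 1) *ᵥ x) ⬝ᵥ (A.deleteSet S ^ (r + 1) *ᵥ x) ≤ ρ * (x ⬝ᵥ x) := by
      simp only [ρ]; linarith
    have hρ : 0 ≤ ρ := by
      have h5 : w ^ (r + 1) ≤ lam ^ (r + 1) := pow_le_pow_left₀ h.pos.le hw _
      have h6 : (w ^ (r + 1)) ^ 2 ≤ (lam ^ (r + 1)) ^ 2 :=
        pow_le_pow_left₀ (pow_nonneg h.pos.le _) h5 _
      simp only [ρ]; linarith
    rw [pow_succ' ρ]
    exact h4.trans (mul_le_mul_of_nonneg_left ih hρ)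

open Classical in
/-- The multiplicity of an eigenvalue that is at least the second largest one, in a connected
weighted graph of bounded degree. -/
theorem IsWeightedAdjacency.finrank_eigenSubmodule_le (h : IsWeightedAdjacency G A w)
    (hlam : 0 < lam) (hw : w ≤ lam) (hG : G.Connected)
    {Δ : ℕ} (hΔ : ∀ v, {u | G.Adj v u}.ncard ≤ Δ)
    (hsum : ∀ x : V → ℝ, ∑ v, x v = 0 → x ⬝ᵥ A *ᵥ x ≤ lam * (x ⬝ᵥ x)) (j m : ℕ) :
    (Module.finrank ℝ (A.eigenSubmodule lam) : ℝ) ≤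
      (Δ + 1) ^ (2 * (2 * (j + 1) * (m + 1) + 1) + 1) + (Fintype.card V / (j + 2) + 1) +
      Fintype.card V * (1 - ((w / lam) ^ (2 * (j + 1))) ^ 2) ^ (m + 1) := by
  have hq0 : 0 ≤ w / lam := div_nonneg h.pos.le hlam.le
  have hq1 : ((w / lam) ^ (2 * (j + 1))) ^ 2 ≤ 1 := by
    rw [← pow_mul]
    exact pow_le_one₀ hq0 ((div_le_one hlam).mpr hw)
  -- The net argument needs a neighbour at every vertex, which fails for a single vertex.
  by_cases hV : Subsingleton V
  · have h1 : Module.finrank ℝ (A.eigenSubmodule lam) ≤ 1 := by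
      refine (Submodule.finrank_le _).trans ?_
      rw [Module.finrank_fintype_fun_eq_card]
      exact Fintype.card_le_one_iff_subsingleton.mpr hV
    have h2 : (Module.finrank ℝ (A.eigenSubmodule lam) : ℝ) ≤ 1 := by exact_mod_cast h1
    have h3 : (0 : ℝ) ≤ (Δ + 1) ^ (2 * (2 * (j + 1) * (m + 1) + 1) + 1) := by positivity
    have h4 : (0 : ℝ) ≤ Fintype.card V / (j + 2) := by positivity
    have h5 : 0 ≤ Fintype.card V * (1 - ((w / lam) ^ (2 * (j + 1))) ^ 2) ^ (m + 1) :=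
      mul_nonneg (Nat.cast_nonneg _) (pow_nonneg (by linarith) _)
    linarith
  have hV' : Nontrivial V := not_subsingleton_iff_nontrivial.mp hV
  have hnbr : ∀ u, ∃ x, G.Adj u x := fun u => hG.preconnected.exists_adj_of_nontrivial u
  obtain ⟨S, hS, hScard⟩ := hG.exists_net (j + 1)
  set R := 2 * (j + 1) * (m + 1) + 1 with hR
  set U := heavyCenters G A lam R
  have hUcard := h.ncard_heavyCenters_le hG hΔ hsum R
  set T : Set V := ↑S ∪ U
  have hTcard : T.ncard ≤ S.card + (Δ + 1) ^ (2 * R + 1) := by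
    refine (Set.ncard_union_le _ _).trans ?_
    rw [Set.ncard_coe_finset]
    exact Nat.add_le_add_left hUcard _
  let f : (V → ℝ) →ₗ[ℝ] (T → ℝ) := LinearMap.funLeft ℝ ℝ Subtype.val
  have h1 := finrank_le_add_finrank_inf_ker (A.eigenSubmodule lam) f
  rw [Module.finrank_fintype_fun_eq_card, ← Nat.card_eq_fintype_card, Nat.card_coe_set_eq] at h1
  set E := A.eigenSubmodule lam ⊓ LinearMap.ker f
  obtain ⟨r, hr⟩ : ∃ r, 2 * (j + 1) = r + 1 := ⟨2 * j + 1, by ring⟩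
  -- Vanishing on `T` costs at most `|T|` dimensions, and such eigenvectors do not notice the
  -- deletion.
  have hE : ∀ x ∈ E, A.deleteSet T *ᵥ x = lam • x := by
    rintro x ⟨hx, hxT⟩
    have hx0 : ∀ v ∈ T, x v = 0 := fun v hv => congrFun (LinearMap.mem_ker.mp hxT) ⟨v, hv⟩
    ext u
    by_cases hu : u ∈ T
    · rw [Pi.smul_apply, hx0 u hu, smul_zero]
      exact Matrix.mulVec_apply_eq_zero fun v hv =>
        absurd (Matrix.deleteSet_apply_of_mem (Or.inl hu)) hv
    · rw [← Matrix.mem_eigenSubmodule.mp hx]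
      refine Finset.sum_congr rfl fun v _ => ?_
      by_cases hv : v ∈ T
      · simp [hx0 v hv]
      · simp [Matrix.deleteSet, hu, hv]
  have h2 := finrank_mul_sq_le_sum_sq (A.deleteSet T ^ ((r + 1) * (m + 1)))
    ((Matrix.deleteSet_isSymm h.isSymm T).pow _) (lam ^ ((r + 1) * (m + 1))) E
    (fun x hx => Matrix.pow_mulVec_eq_smul (hE x hx) _)
  set ρ := (lam ^ (r + 1)) ^ 2 - (w ^ (r + 1)) ^ 2 with hρdef
  have hρ : 0 ≤ ρ := by
    have h5 : w ^ (r + 1) ≤ lam ^ (r + 1) := pow_le_pow_left₀ h.pos.le hw _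
    have h6 : (w ^ (r + 1)) ^ 2 ≤ (lam ^ (r + 1)) ^ 2 :=
      pow_le_pow_left₀ (pow_nonneg h.pos.le _) h5 _
    simp only [ρ]; linarith
  have hcol : ∀ v, ∑ u, (A.deleteSet T ^ ((r + 1) * (m + 1))) u v ^ 2 ≤ ρ ^ (m + 1) := by
    intro v
    have hmul : ∑ u, (A.deleteSet T ^ ((r + 1) * (m + 1))) u v ^ 2 =
        (A.deleteSet T ^ ((r + 1) * (m + 1)) *ᵥ Pi.single v 1) ⬝ᵥ
        (A.deleteSet T ^ ((r + 1) * (m + 1)) *ᵥ Pi.single v 1) := by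
      rw [Matrix.mulVec_single_one]
      refine Finset.sum_congr rfl fun u _ => ?_
      rw [Matrix.col_apply, sq]
    rw [hmul]
    -- Heavy centers were deleted along with the net, so their columns vanish.
    by_cases hv : v ∈ U
    · have h0 : A.deleteSet T ^ ((r + 1) * (m + 1)) *ᵥ Pi.single v 1 = 0 := by
        obtain ⟨k, hk⟩ : ∃ k, (r + 1) * (m + 1) = k + 1 := ⟨r * m + r + m, by ring⟩
        rw [hk, pow_succ, ← Matrix.mulVec_mulVec]
        have : A.deleteSet T *ᵥ Pi.single v 1 = 0 := by
          rw [Matrix.mulVec_single_one]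
          ext u
          exact Matrix.deleteSet_apply_of_mem (Or.inr (Or.inr hv))
        rw [this, Matrix.mulVec_zero]
      rw [h0, zero_dotProduct]
      exact pow_nonneg hρ _
    · refine h.deleteSet_pow_single_sq_le hlam hw hG hnbr T r (m + 1) ?_ ?_ _ le_rfl
      · intro u
        obtain ⟨s, hs, hd⟩ := hS u
        exact ⟨s, Or.inl hs, by rw [SimpleGraph.dist_comm, ← hr]; exact hd⟩
      · rw [← hr]; exact hv
  have h3 : (Module.finrank ℝ E : ℝ) * (lam ^ ((r + 1) * (m + 1))) ^ 2 ≤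
      Fintype.card V * ρ ^ (m + 1) := by
    refine h2.trans ((Finset.sum_le_sum fun v _ => hcol v).trans ?_)
    simp
  have h4 : (Module.finrank ℝ E : ℝ) ≤
      Fintype.card V * (1 - ((w / lam) ^ (2 * (j + 1))) ^ 2) ^ (m + 1) := by
    have hpos : 0 < (lam ^ ((r + 1) * (m + 1))) ^ 2 := by positivity
    rw [← le_div_iff₀ hpos] at h3
    refine h3.trans (le_of_eq ?_)
    have h5 : 1 - ((w / lam) ^ (2 * (j + 1))) ^ 2 = ρ / (lam ^ (r + 1)) ^ 2 := by
      rw [hr, hρdef, div_pow, sub_div, div_self (by positivity), div_pow]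
    rw [h5, div_pow, mul_div_assoc]
    congr 2
    ring
  have h6 : (Module.finrank ℝ (A.eigenSubmodule lam) : ℝ) ≤
      S.card + (Δ + 1) ^ (2 * R + 1) + Module.finrank ℝ E := by
    exact_mod_cast h1.trans (Nat.add_le_add_right hTcard _)
  have h7 : (S.card : ℝ) ≤ Fintype.card V / (j + 2) + 1 := by
    refine hScard.trans (le_of_eq ?_)
    push_cast
    ring
  linarith

end Multiplicity

/-! ### Optimising the parameters -/

section Growth

/-- The loss per block is `P ^ (-(j + 1))` with `P = (lam / w) ^ 4`, so about `(j + 2) * P ^ (j +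
1)` blocks bring the decay down to the net density `1 / (j + 2)`. The ball radius is then
exponential in `j`, and the ball size doubly exponential. -/
theorem exists_exp_exp_bound {w lam : ℝ} (hw0 : 0 < w) (hw : w ≤ lam) (Δ : ℕ) :
    ∃ a : ℝ, 0 < a ∧ ∀ j : ℕ, ∃ m : ℕ,
      ((Δ : ℝ) + 1) ^ (2 * (2 * (j + 1) * (m + 1) + 1) + 1) + 1 ≤
        Real.exp (Real.exp (a * (j + 1))) ∧
      (1 - ((w / lam) ^ (2 * (j + 1))) ^ 2) ^ (m + 1) ≤ 1 / ((j : ℝ) + 2) := by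
  have hlam : 0 < lam := hw0.trans_le hw
  set P : ℝ := (lam / w) ^ 4 with hP
  have hP1 : 1 ≤ P := one_le_pow₀ ((one_le_div hw0).mpr hw)
  have hP0 : 0 < P := by linarith
  have hΔ : (0 : ℝ) ≤ Δ := Nat.cast_nonneg _
  refine ⟨Real.log (Δ + 2) + 5 + Real.log P, ?_, fun j => ?_⟩
  · have h1 : 0 ≤ Real.log ((Δ : ℝ) + 2) := Real.log_nonneg (by linarith)
    have h2 : 0 ≤ Real.log P := Real.log_nonneg hP1
    linarith
  have hj : (0 : ℝ) ≤ j := Nat.cast_nonneg _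
  have hPj : 1 ≤ P ^ (j + 1) := one_le_pow₀ hP1
  have hPj0 : 0 < P ^ (j + 1) := by linarith
  have hq : ((w / lam) ^ (2 * (j + 1))) ^ 2 = (P ^ (j + 1))⁻¹ := by
    rw [hP, ← pow_mul, ← pow_mul, ← inv_pow, inv_div]
    congr 1
    ring
  have hx : 0 < ((j : ℝ) + 2) * P ^ (j + 1) := by positivity
  obtain ⟨m, hm⟩ : ∃ m, ⌈((j : ℝ) + 2) * P ^ (j + 1)⌉₊ = m + 1 :=
    ⟨_, (Nat.succ_pred_eq_of_pos (Nat.ceil_pos.mpr hx)).symm⟩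
  have hm1 : ((j : ℝ) + 2) * P ^ (j + 1) ≤ m + 1 := by
    have := Nat.le_ceil (((j : ℝ) + 2) * P ^ (j + 1))
    rw [hm] at this
    exact_mod_cast this
  have hm2 : (m : ℝ) + 1 ≤ ((j : ℝ) + 2) * P ^ (j + 1) + 1 := by
    have := (Nat.ceil_lt_add_one hx.le).le
    rw [hm] at this
    exact_mod_cast this
  refine ⟨m, ?_, ?_⟩
  · set e := 2 * (2 * (j + 1) * (m + 1) + 1) + 1 with he
    -- Base `Δ + 2` absorbs the extra `1` and keeps the logarithm positive.
    have h1 : ((Δ : ℝ) + 1) ^ e + 1 ≤ (Δ + 2) ^ e := by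
      have := pow_add_pow_le (x := (Δ : ℝ) + 1) (y := 1) (by linarith) zero_le_one
        (n := e) (by omega)
      rw [one_pow] at this
      refine this.trans (le_of_eq ?_)
      ring
    have h2 : ((Δ : ℝ) + 2) ^ e = Real.exp (e * Real.log (Δ + 2)) := by
      rw [Real.exp_nat_mul, Real.exp_log (by linarith)]
    have h3 : (e : ℝ) ≤ 11 * ((j : ℝ) + 2) ^ 2 * P ^ (j + 1) := by
      have h4 : (e : ℝ) = 4 * (j + 1) * (m + 1) + 3 := by rw [he]; push_cast; ring
      have h5 : ((j : ℝ) + 1) * (m + 1) ≤ (j + 1) * (((j : ℝ) + 2) * P ^ (j + 1) + 1) :=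
        mul_le_mul_of_nonneg_left hm2 (by linarith)
      have h6 : (1 : ℝ) * (j + 2) ≤ P ^ (j + 1) * (j + 2) :=
        mul_le_mul_of_nonneg_right hPj (by linarith)
      have h7 : ((j : ℝ) + 2) * (P ^ (j + 1) * (j + 2)) ≥ (j + 2) * (1 * (j + 2)) :=
        mul_le_mul_of_nonneg_left h6 (by linarith)
      have h8 : 0 ≤ ((j : ℝ) + 2) * P ^ (j + 1) := hx.le
      rw [h4]
      nlinarith
    have h4 : Real.log ((Δ : ℝ) + 2) ≤ Real.exp (Real.log (Δ + 2)) := by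
      have := Real.add_one_le_exp (Real.log ((Δ : ℝ) + 2))
      linarith
    have h5 : (11 : ℝ) ≤ Real.exp 3 := by
      have h9 := Real.exp_one_gt_d9
      have h10 : Real.exp 3 = Real.exp 1 ^ 3 := by rw [← Real.exp_nat_mul]; norm_num
      rw [h10]
      calc (11 : ℝ) ≤ 2.5 ^ 3 := by norm_num
        _ ≤ _ := by gcongr; linarith
    have h6 : ((j : ℝ) + 2) ^ 2 ≤ Real.exp (2 * (j + 1)) := by
      have h9 : (j : ℝ) + 2 ≤ Real.exp (j + 1) := by
        have := Real.add_one_le_exp ((j : ℝ) + 1)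
        linarith
      have h10 : Real.exp (2 * ((j : ℝ) + 1)) = Real.exp (j + 1) ^ 2 := by
        rw [← Real.exp_nat_mul]; norm_num
      rw [h10]
      exact pow_le_pow_left₀ (by linarith) h9 2
    have h7 : P ^ (j + 1) = Real.exp ((j + 1) * Real.log P) := by
      have := Real.exp_nat_mul (Real.log P) (j + 1)
      rw [Real.exp_log hP0] at this
      rw [← this]
      push_cast
      rfl
    have hl0 : 0 ≤ Real.log ((Δ : ℝ) + 2) := Real.log_nonneg (by linarith)
    refine h1.trans ?_
    rw [h2, Real.exp_le_exp]
    calc (e : ℝ) * Real.log (Δ + 2)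
        ≤ (11 * ((j : ℝ) + 2) ^ 2 * P ^ (j + 1)) * Real.exp (Real.log (Δ + 2)) := by
          exact mul_le_mul h3 h4 hl0 (by positivity)
      _ ≤ (Real.exp 3 * Real.exp (2 * (j + 1)) * Real.exp ((j + 1) * Real.log P)) *
            Real.exp (Real.log (Δ + 2)) := by
          rw [h7]
          gcongr
      _ = Real.exp (3 + 2 * (j + 1) + (j + 1) * Real.log P + Real.log (Δ + 2)) := by
          rw [Real.exp_add, Real.exp_add, Real.exp_add]
      _ ≤ _ := by
          rw [Real.exp_le_exp]
          nlinarith [mul_nonneg hj hl0]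
  · rw [hq]
    have h1 : (1 - (P ^ (j + 1))⁻¹) ^ (m + 1) ≤ Real.exp (-(P ^ (j + 1))⁻¹) ^ (m + 1) := by
      refine pow_le_pow_left₀ ?_ ?_ _
      · have := inv_le_one_of_one_le₀ hPj
        linarith
      · have := Real.add_one_le_exp (-(P ^ (j + 1))⁻¹)
        linarith
    refine h1.trans ?_
    rw [← Real.exp_nat_mul, one_div, mul_neg, Real.exp_neg]
    refine inv_anti₀ (by linarith) ?_
    have h2 : (j : ℝ) + 2 ≤ ((m + 1 : ℕ) : ℝ) * (P ^ (j + 1))⁻¹ := by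
      rw [← div_eq_mul_inv, le_div_iff₀ hPj0]
      push_cast
      exact hm1
    have h3 := Real.add_one_le_exp (((m + 1 : ℕ) : ℝ) * (P ^ (j + 1))⁻¹)
    linarith

theorem exists_const_le_add_div_log_log {a : ℝ} (ha : 0 < a) :
    ∃ K : ℝ, ∀ d n : ℕ, 3 ≤ d →
      (∀ j : ℕ, (n : ℝ) ≤ d + 1 + Real.exp (Real.exp (a * (j + 1))) + 2 * (n / (j + 2))) →
      (n : ℝ) ≤ d + K * (d / Real.log (Real.log d)) := by
  set E := Real.exp (Real.exp (a * ((2 : ℕ) + 1))) with hE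
  have hE0 : 0 < E := Real.exp_pos _
  set C := 4 + 2 * E with hC
  refine ⟨4 + 2 * C * (a + 1), fun d n hd h => ?_⟩
  have hd3 : (3 : ℝ) ≤ d := by exact_mod_cast hd
  have hlog : 1 < Real.log d := by
    rw [Real.lt_log_iff_exp_lt (by linarith)]
    exact Real.exp_one_lt_d9.trans_le (by linarith)
  set ℓ := Real.log (Real.log d) with hℓ
  have hℓ0 : 0 < ℓ := Real.log_pos hlog
  have hexpℓ : Real.exp ℓ = Real.log d := Real.exp_log (by linarith)
  have hn : (n : ℝ) ≤ C * d := by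
    have h2 := h 2
    rw [← hE] at h2
    push_cast at h2
    have h3 : E * 1 ≤ E * d := mul_le_mul_of_nonneg_left (by linarith) hE0.le
    rw [hC]
    linarith
  have hC0 : 0 < C := by linarith
  have hd0 : (0 : ℝ) < d := by linarith
  have hdl : 0 < d / ℓ := div_pos hd0 hℓ0
  rcases le_or_gt ℓ (a + 1) with hle | hgt
  · have h1 : (d : ℝ) ≤ (a + 1) * (d / ℓ) := by
      rw [← mul_div_assoc, le_div_iff₀ hℓ0, mul_comm]
      exact mul_le_mul_of_nonneg_right hle hd0.le
    have h2 := mul_le_mul_of_nonneg_left h1 hC0.le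
    have h3 : 0 ≤ C * ((a + 1) * (d / ℓ)) := by positivity
    calc (n : ℝ) ≤ C * d := hn
      _ ≤ d + (4 + 2 * C * (a + 1)) * (d / ℓ) := by linarith
  · have hx1 : 1 ≤ (ℓ - 1) / a := by rw [one_le_div ha]; linarith
    -- With this `j` the double exponential is at most `√d`, while `j + 2` is still of order `log
    -- log d`.
    obtain ⟨j, hj⟩ : ∃ j, ⌊(ℓ - 1) / a⌋₊ = j + 1 :=
      ⟨_, (Nat.succ_pred_eq_of_pos (Nat.floor_pos.mpr hx1)).symm⟩
    have hj1 : a * ((j : ℝ) + 1) ≤ ℓ - 1 := by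
      have := Nat.floor_le (zero_le_one.trans hx1)
      rw [hj, le_div_iff₀ ha] at this
      push_cast at this
      linarith
    have hj2 : ℓ / (a + 1) ≤ (j : ℝ) + 2 := by
      have := (Nat.lt_floor_add_one ((ℓ - 1) / a)).le
      rw [hj] at this
      push_cast at this
      refine le_trans ?_ (this.trans (by linarith))
      rw [div_le_div_iff₀ (by linarith) ha]
      linarith
    have h1 := h j
    set s := Real.sqrt d with hs
    have hs2 : s * s = d := Real.mul_self_sqrt hd0.le
    have hs1 : 1 ≤ s := Real.one_le_sqrt.mpr (by linarith)
    have hlogd : Real.log d = 2 * Real.log s := by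
      rw [← hs2, Real.log_mul (by linarith) (by linarith)]; ring
    have h2 : Real.exp (Real.exp (a * ((j : ℝ) + 1))) ≤ s := by
      have h3 : Real.exp (a * ((j : ℝ) + 1)) ≤ Real.log s := by
        refine (Real.exp_le_exp.mpr hj1).trans ?_
        rw [Real.exp_sub, hexpℓ, hlogd, div_le_iff₀ (Real.exp_pos 1), mul_comm]
        have h4 := Real.add_one_le_exp (1 : ℝ)
        exact mul_le_mul_of_nonneg_left (by linarith) (Real.log_nonneg hs1)
      refine (Real.exp_le_exp.mpr h3).trans ?_
      rw [Real.exp_log (by linarith)]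
    have h3 : s ≤ 2 * (d / ℓ) := by
      rw [← mul_div_assoc, le_div_iff₀ hℓ0]
      have h4 : ℓ ≤ 2 * s := by
        have h5 := Real.add_one_le_exp ℓ
        have h6 := Real.log_le_sub_one_of_pos (show 0 < s by linarith)
        rw [hexpℓ, hlogd] at h5
        linarith
      calc s * ℓ ≤ s * (2 * s) := mul_le_mul_of_nonneg_left h4 (by linarith)
        _ = 2 * d := by rw [← hs2]; ring
    have h4 : (n : ℝ) / (j + 2) ≤ C * (a + 1) * (d / ℓ) := by
      have h5 : 0 < ℓ / (a + 1) := by positivity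
      calc (n : ℝ) / (j + 2) ≤ (C * d) / (ℓ / (a + 1)) :=
            div_le_div₀ (by positivity) hn h5 hj2
        _ = _ := by field_simp
    calc (n : ℝ) ≤ d + 1 + Real.exp (Real.exp (a * (j + 1))) + 2 * (n / (j + 2)) := h1
      _ ≤ d + (4 + 2 * C * (a + 1)) * (d / ℓ) := by linarith

end Growth

/-! ### Components, Perron-Frobenius and the two rank bounds -/

section Components

open scoped Matrix

theorem Matrix.extend_dotProduct_extend {ι V : Type*} [Fintype ι] [Fintype V] {e : ι → V}
    (he : Function.Injective e) (x : ι → ℝ) (y : V → ℝ) :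
    Function.extend e x 0 ⬝ᵥ y = x ⬝ᵥ (y ∘ e) := by
  classical
  symm
  refine Finset.sum_of_injOn e he.injOn (by simp) ?_ ?_
  · intro v _ hv
    rw [Function.extend_apply' _ _ _ (by simpa using hv)]
    simp
  · intro i _
    rw [he.extend_apply]
    rfl

theorem Matrix.submatrix_mulVec_eq_extend {ι V : Type*} [Fintype ι] [Fintype V] {e : ι → V}
    (he : Function.Injective e) (M : Matrix V V ℝ) (x : ι → ℝ) :
    M.submatrix e e *ᵥ x = (M *ᵥ Function.extend e x 0) ∘ e := by
  ext i
  have h := Matrix.extend_dotProduct_extend he x (M (e i))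
  rw [dotProduct_comm, dotProduct_comm x] at h
  exact h.symm

theorem Matrix.extend_comp_of_forall_notMem_range {ι V : Type*} {e : ι → V}
    (he : Function.Injective e) {x : V → ℝ} (hx : ∀ v, v ∉ Set.range e → x v = 0) :
    Function.extend e (x ∘ e) 0 = x := by
  ext v
  by_cases hv : ∃ i, e i = v
  · obtain ⟨i, rfl⟩ := hv
    rw [he.extend_apply]; rfl
  · rw [Function.extend_apply' _ _ _ hv, hx v hv]
    rfl

variable {V : Type*} {G : SimpleGraph V} {A : Matrix V V ℝ} {w lam : ℝ}

/-- The function `x` vanishes outside the component `K`. -/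
def SimpleGraph.ConnectedComponent.Supports (K : G.ConnectedComponent) (x : V → ℝ) : Prop :=
  ∀ v, G.connectedComponentMk v ≠ K → x v = 0

/-- The restriction of `x` to the component `K`, extended by zero. -/
noncomputable def SimpleGraph.ConnectedComponent.restrict (K : G.ConnectedComponent) (x : V → ℝ) :
    V → ℝ :=
  open Classical in fun v => if G.connectedComponentMk v = K then x v else 0

theorem SimpleGraph.ConnectedComponent.supports_restrict (K : G.ConnectedComponent) (x : V → ℝ) :
    K.Supports (K.restrict x) := fun v hv => by
  simp [SimpleGraph.ConnectedComponent.restrict, hv]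

theorem SimpleGraph.ConnectedComponent.restrict_mk_apply (x : V → ℝ) (v : V) :
    (G.connectedComponentMk v).restrict x v = x v := by
  simp [SimpleGraph.ConnectedComponent.restrict]

theorem SimpleGraph.ConnectedComponent.restrict_smul (K : G.ConnectedComponent) (c : ℝ)
    (x : V → ℝ) : K.restrict (c • x) = c • K.restrict x := by
  ext v
  simp [SimpleGraph.ConnectedComponent.restrict]

theorem SimpleGraph.ConnectedComponent.eq_zero_of_forall_restrict {x : V → ℝ}
    (h : ∀ K : G.ConnectedComponent, K.restrict x = 0) : x = 0 := by
  ext v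
  rw [← SimpleGraph.ConnectedComponent.restrict_mk_apply (G := G) x v, h]

theorem SimpleGraph.ConnectedComponent.Supports.abs {K : G.ConnectedComponent} {x : V → ℝ}
    (h : K.Supports x) : K.Supports |x| := fun v hv => by simp [h v hv]

theorem SimpleGraph.ConnectedComponent.Supports.separated {K L : G.ConnectedComponent}
    {x y : V → ℝ} (hx : K.Supports x) (hy : L.Supports y) (hKL : K ≠ L) (u v : V) (hu : x u ≠ 0)
    (hv : y v ≠ 0) : u ≠ v ∧ ¬ G.Adj u v := by
  have h1 : G.connectedComponentMk u = K := by by_contra hc; exact hu (hx u hc)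
  have h2 : G.connectedComponentMk v = L := by by_contra hc; exact hv (hy v hc)
  refine ⟨?_, fun hadj => hKL ?_⟩
  · rintro rfl
    exact hKL (h1.symm.trans h2)
  · rw [← h1, ← h2]
    exact SimpleGraph.ConnectedComponent.connectedComponentMk_eq_of_adj hadj

variable [Fintype V]

theorem SimpleGraph.ConnectedComponent.sum_restrict_dotProduct [Fintype G.ConnectedComponent]
    (x y : V → ℝ) : ∑ K : G.ConnectedComponent, K.restrict x ⬝ᵥ K.restrict y = x ⬝ᵥ y := by
  classical
  have := Finset.sum_fiberwise Finset.univ G.connectedComponentMk (fun v => x v * y v)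
  rw [dotProduct, ← this]
  refine Finset.sum_congr rfl fun K _ => ?_
  rw [Finset.sum_filter]
  refine Finset.sum_congr rfl fun v _ => ?_
  simp only [SimpleGraph.ConnectedComponent.restrict]
  split_ifs <;> simp

theorem IsWeightedAdjacency.mulVec_restrict (h : IsWeightedAdjacency G A w)
    (K : G.ConnectedComponent) (x : V → ℝ) : A *ᵥ K.restrict x = K.restrict (A *ᵥ x) := by
  ext u
  have hadj : ∀ v, A u v ≠ 0 → G.connectedComponentMk v = G.connectedComponentMk u := fun v hv =>
    (SimpleGraph.ConnectedComponent.connectedComponentMk_eq_of_adj (h.adj_of_ne_zero hv)).symm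
  by_cases hu : G.connectedComponentMk u = K
  · simp only [SimpleGraph.ConnectedComponent.restrict, hu, if_true]
    refine Finset.sum_congr rfl fun v _ => ?_
    by_cases hv : A u v = 0
    · simp [hv]
    · simp [SimpleGraph.ConnectedComponent.restrict, hadj v hv, hu]
  · rw [K.supports_restrict _ u hu]
    refine Matrix.mulVec_apply_eq_zero fun v hv => K.supports_restrict _ v ?_
    rwa [hadj v hv]

/-- The quadratic form of `lam - A` is nonnegative on the component `K`. -/
def SimpleGraph.ConnectedComponent.IsNonneg (A : Matrix V V ℝ) (lam : ℝ)
    (K : G.ConnectedComponent) : Prop :=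
  ∀ x : V → ℝ, K.Supports x → x ⬝ᵥ A *ᵥ x ≤ lam * (x ⬝ᵥ x)

/-- The restriction of `lam - A` to the component `K` is positive semidefinite and singular. -/
def SimpleGraph.ConnectedComponent.IsSingular (A : Matrix V V ℝ) (lam : ℝ)
    (K : G.ConnectedComponent) : Prop :=
  K.IsNonneg A lam ∧ ∃ x : V → ℝ, x ≠ 0 ∧ K.Supports x ∧ A *ᵥ x = lam • x

/-- A zero of a positive semidefinite form is a minimiser, so the first variation in the direction
`y = A x - lam x`, which is again supported on `K`, must vanish. -/
theorem IsWeightedAdjacency.mulVec_eq_smul_of_isNonneg (h : IsWeightedAdjacency G A w)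
    {K : G.ConnectedComponent} (hK : K.IsNonneg A lam) {x : V → ℝ} (hx : K.Supports x)
    (hq : lam * (x ⬝ᵥ x) ≤ x ⬝ᵥ A *ᵥ x) : A *ᵥ x = lam • x := by
  have hAx : K.Supports (A *ᵥ x) := fun u hu =>
    Matrix.mulVec_apply_eq_zero fun v hv => hx v fun hv' => hu (by
      rw [← hv']
      exact SimpleGraph.ConnectedComponent.connectedComponentMk_eq_of_adj (h.adj_of_ne_zero hv))
  set y := A *ᵥ x - lam • x with hy
  have hyK : K.Supports y := fun v hv => by simp [hy, hx v hv, hAx v hv]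
  have hself : y ⬝ᵥ y = y ⬝ᵥ A *ᵥ x - lam * (y ⬝ᵥ x) := by
    conv_lhs => rw [hy, dotProduct_sub, dotProduct_smul, smul_eq_mul]
  have hquad : ∀ t : ℝ, 0 ≤ t * t * (lam * (y ⬝ᵥ y) - y ⬝ᵥ A *ᵥ y) - 2 * t * (y ⬝ᵥ y) := by
    intro t
    have h1 := hK (x + t • y) fun v hv => by simp [hx v hv, hyK v hv]
    have h2 := h.isSymm.dotProduct_mulVec_comm x y
    simp only [Matrix.mulVec_add, add_dotProduct, dotProduct_add, Matrix.mulVec_smul,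
      smul_dotProduct, dotProduct_smul, smul_eq_mul, h2, dotProduct_comm x y] at h1
    have h3 : t * (y ⬝ᵥ y) = t * (y ⬝ᵥ A *ᵥ x - lam * (y ⬝ᵥ x)) := by rw [← hself]
    nlinarith
  have hyy : y ⬝ᵥ y ≤ 0 := by
    by_contra! hpos
    set b := lam * (y ⬝ᵥ y) - y ⬝ᵥ A *ᵥ y
    set c := y ⬝ᵥ y
    have hb : 0 < |b| + 1 := by positivity
    have h1 := hquad (c / (|b| + 1))
    have h2 : c / (|b| + 1) * (|b| + 1) = c := by field_simp
    set t := c / (|b| + 1)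
    have ht : 0 < t := div_pos hpos hb
    have h3 : t * b ≤ t * |b| := mul_le_mul_of_nonneg_left (le_abs_self b) ht.le
    have h4 : t * b < c := by nlinarith
    nlinarith
  have h0 : y = 0 := dotProduct_self_eq_zero.mp
    (le_antisymm hyy (Finset.sum_nonneg fun v _ => mul_self_nonneg _))
  exact sub_eq_zero.mp h0

theorem IsWeightedAdjacency.abs_mulVec_eq_smul (h : IsWeightedAdjacency G A w)
    {K : G.ConnectedComponent} (hK : K.IsNonneg A lam) {x : V → ℝ} (hx : K.Supports x)
    (hAx : A *ᵥ x = lam • x) : A *ᵥ |x| = lam • |x| := by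
  refine h.mulVec_eq_smul_of_isNonneg hK hx.abs ?_
  have := h.dotProduct_mulVec_le_abs x x
  rwa [hAx, dotProduct_smul, smul_eq_mul, ← dotProduct_abs_self] at this

/-- Perron-Frobenius: a null vector of a nonnegative component vanishing at one vertex is zero. -/
theorem IsWeightedAdjacency.eq_zero_of_apply_eq_zero (h : IsWeightedAdjacency G A w)
    {K : G.ConnectedComponent} (hK : K.IsNonneg A lam) {x : V → ℝ} (hx : K.Supports x)
    (hAx : A *ᵥ x = lam • x) {u : V} (hu : G.connectedComponentMk u = K) (hxu : x u = 0) :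
    x = 0 := by
  have habs := h.abs_mulVec_eq_smul hK hx hAx
  -- At a zero of `|x|` the eigenvalue equation is a vanishing sum of nonnegative terms, so zeros
  -- propagate along edges.
  have hstep : ∀ a b, G.Adj a b → x a = 0 → x b = 0 := by
    intro a b hab ha
    have h1 := congrFun habs a
    rw [Pi.smul_apply, Pi.abs_apply, ha, abs_zero, smul_zero] at h1
    have h2 := (Finset.sum_eq_zero_iff_of_nonneg
      (fun v _ => mul_nonneg (h.nonneg a v) (abs_nonneg (x v)))).mp h1 b (Finset.mem_univ b)
    rcases mul_eq_zero.mp h2 with h3 | h3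
    · exact absurd h3 (h.pos.trans_le (h.le_of_adj hab)).ne'
    · exact abs_eq_zero.mp h3
  ext v
  by_cases hv : G.connectedComponentMk v = K
  · obtain ⟨p⟩ := SimpleGraph.ConnectedComponent.exact (hu.trans hv.symm)
    clear hu hv
    induction p with
    | nil => exact hxu
    | cons hadj _ ih => exact ih (hstep _ _ hadj hxu)
  · exact hx v hv

theorem IsWeightedAdjacency.restrict_mulVec_eq_smul (h : IsWeightedAdjacency G A w)
    {x : V → ℝ} (hAx : A *ᵥ x = lam • x) (K : G.ConnectedComponent) :
    A *ᵥ K.restrict x = lam • K.restrict x := by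
  rw [h.mulVec_restrict, hAx, K.restrict_smul]

theorem IsWeightedAdjacency.restrict_eq_zero_of_not_isSingular (h : IsWeightedAdjacency G A w)
    {x : V → ℝ} (hAx : A *ᵥ x = lam • x) {K : G.ConnectedComponent} (hK : K.IsNonneg A lam)
    (hs : ¬ K.IsSingular A lam) : K.restrict x = 0 := by
  by_contra h0
  exact hs ⟨hK, _, h0, K.supports_restrict x, h.restrict_mulVec_eq_smul hAx K⟩

theorem IsWeightedAdjacency.mulVec_eq_smul_of_forall_isNonneg (h : IsWeightedAdjacency G A w)
    (hall : ∀ K : G.ConnectedComponent, K.IsNonneg A lam) {x : V → ℝ}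
    (hq : lam * (x ⬝ᵥ x) ≤ x ⬝ᵥ A *ᵥ x) : A *ᵥ x = lam • x := by
  classical
  have : Fintype G.ConnectedComponent := Fintype.ofFinite _
  have h1 : ∀ K ∈ (Finset.univ : Finset G.ConnectedComponent),
      0 ≤ lam * (K.restrict x ⬝ᵥ K.restrict x) - K.restrict x ⬝ᵥ A *ᵥ K.restrict x := fun K _ =>
    sub_nonneg.mpr (hall K _ (K.supports_restrict x))
  have h2 : ∑ K : G.ConnectedComponent,
      (lam * (K.restrict x ⬝ᵥ K.restrict x) - K.restrict x ⬝ᵥ A *ᵥ K.restrict x) =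
      lam * (x ⬝ᵥ x) - x ⬝ᵥ A *ᵥ x := by
    simp only [h.mulVec_restrict, Finset.sum_sub_distrib, ← Finset.mul_sum,
      SimpleGraph.ConnectedComponent.sum_restrict_dotProduct]
  have h3 := (Finset.sum_eq_zero_iff_of_nonneg h1).mp
    (le_antisymm (h2.trans_le (by linarith)) (Finset.sum_nonneg h1))
  ext v
  have h4 := h.mulVec_eq_smul_of_isNonneg (hall (G.connectedComponentMk v))
    (SimpleGraph.ConnectedComponent.supports_restrict _ x)
    (sub_nonpos.mp (h3 _ (Finset.mem_univ _)).le)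
  rw [h.mulVec_restrict, ← SimpleGraph.ConnectedComponent.restrict_smul] at h4
  have h5 := congrFun h4 v
  rwa [SimpleGraph.ConnectedComponent.restrict_mk_apply,
    SimpleGraph.ConnectedComponent.restrict_mk_apply] at h5

/-- `T` realizes the quadratic form `lam - A + α J` as a Gram form. -/
def IsGramRealization {W : Type*} [NormedAddCommGroup W] [InnerProductSpace ℝ W]
    (A : Matrix V V ℝ) (lam α : ℝ) (T : (V → ℝ) →ₗ[ℝ] W) : Prop :=
  ∀ x y : V → ℝ, inner ℝ (T x) (T y) =
    lam * (x ⬝ᵥ y) - x ⬝ᵥ A *ᵥ y + α * ((∑ v, x v) * ∑ v, y v)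

variable {W : Type*} [NormedAddCommGroup W] [InnerProductSpace ℝ W] {α : ℝ}
  {T : (V → ℝ) →ₗ[ℝ] W}

theorem IsGramRealization.dotProduct_mulVec_le (hT : IsGramRealization A lam α T) {x : V → ℝ}
    (hx : ∑ v, x v = 0) : x ⬝ᵥ A *ᵥ x ≤ lam * (x ⬝ᵥ x) := by
  have h1 := hT x x
  have h2 : 0 ≤ inner ℝ (T x) (T x) := real_inner_self_nonneg
  rw [h1, hx] at h2
  linarith

theorem IsGramRealization.eigen_of_isNonneg (hT : IsGramRealization A lam α T) (hα : 0 < α)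
    (h : IsWeightedAdjacency G A w) (hall : ∀ K : G.ConnectedComponent, K.IsNonneg A lam)
    {x : V → ℝ} (hx : T x = 0) : A *ᵥ x = lam • x := by
  refine h.mulVec_eq_smul_of_forall_isNonneg hall ?_
  have h1 := hT x x
  rw [hx, inner_zero_left] at h1
  have h2 : 0 ≤ α * ((∑ v, x v) * ∑ v, x v) := mul_nonneg hα.le (mul_self_nonneg _)
  linarith

variable [FiniteDimensional ℝ W]

theorem card_le_finrank_add_finrank_ker (T : (V → ℝ) →ₗ[ℝ] W) :
    Fintype.card V ≤ Module.finrank ℝ W + Module.finrank ℝ (LinearMap.ker T) := by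
  have h1 := LinearMap.finrank_range_add_finrank_ker T
  rw [Module.finrank_fintype_fun_eq_card] at h1
  have h2 := Submodule.finrank_le (LinearMap.range T)
  omega

/-- The null vector of one singular component forces every other component to be dominated by `lam`.
-/
theorem IsGramRealization.card_lt_finrank_add_ncard (hT : IsGramRealization A lam α T)
    (hα : 0 < α) (h : IsWeightedAdjacency G A w)
    (hr : {K : G.ConnectedComponent | K.IsSingular A lam}.ncard ≠ 0) :
    Fintype.card V <
      Module.finrank ℝ W + {K : G.ConnectedComponent | K.IsSingular A lam}.ncard := by
  classical
  obtain ⟨K₀, hK₀, x₀, hx₀, hx₀K, hAx₀⟩ := Set.nonempty_of_ncard_ne_zero hr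
  have hall : ∀ K : G.ConnectedComponent, K.IsNonneg A lam := by
    intro K y hy
    by_contra! hc
    have hne : K ≠ K₀ := by
      rintro rfl
      exact absurd (hK₀ y hy) (not_le.mpr hc)
    refine h.false_of_separated (fun x hx => hT.dotProduct_mulVec_le hx)
      (hy.separated hx₀K hne) hc ?_ hx₀
    rw [hAx₀, dotProduct_smul, smul_eq_mul]
  set S := {K : G.ConnectedComponent | K.IsSingular A lam}
  have hker : LinearMap.ker T ≤ A.eigenSubmodule lam := fun x hx =>
    hT.eigen_of_isNonneg hα h hall (LinearMap.mem_ker.mp hx)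
  -- `|x₀|` is an eigenvector with positive sum, so `‖T |x₀|‖² = α (∑ |x₀|)² > 0`.
  have hlt : LinearMap.ker T < A.eigenSubmodule lam := by
    refine lt_of_le_of_ne hker fun heq => ?_
    have hmem : |x₀| ∈ A.eigenSubmodule lam := h.abs_mulVec_eq_smul hK₀ hx₀K hAx₀
    have h1 := hT |x₀| |x₀|
    rw [← heq, LinearMap.mem_ker] at hmem
    rw [hmem, inner_zero_left, h.abs_mulVec_eq_smul hK₀ hx₀K hAx₀, dotProduct_smul,
      smul_eq_mul, sub_self, zero_add] at h1
    obtain ⟨v, hv⟩ := Function.ne_iff.mp hx₀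
    have h2 : 0 < ∑ v, |x₀| v :=
      Finset.sum_pos' (fun v _ => abs_nonneg (x₀ v)) ⟨v, Finset.mem_univ _, abs_pos.mpr hv⟩
    exact absurd h1 (mul_pos hα (mul_pos h2 h2)).ne
  have h1 : Module.finrank ℝ (A.eigenSubmodule lam) ≤ S.ncard := by
    -- Evaluation at one vertex per singular component is injective on the eigenspace.
    choose rep hrep using fun K : S => K.1.exists_rep
    let f : (V → ℝ) →ₗ[ℝ] (S → ℝ) := LinearMap.funLeft ℝ ℝ rep
    have := finrank_le_of_forall_eq_zero (A.eigenSubmodule lam) f fun x hx hfx => by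
      refine SimpleGraph.ConnectedComponent.eq_zero_of_forall_restrict (G := G) fun K => ?_
      by_cases hK : K ∈ S
      · have h2 : x (rep ⟨K, hK⟩) = 0 := congrFun hfx ⟨K, hK⟩
        refine h.eq_zero_of_apply_eq_zero (hall K) (K.supports_restrict x)
          (h.restrict_mulVec_eq_smul hx K) (hrep ⟨K, hK⟩) ?_
        simp [SimpleGraph.ConnectedComponent.restrict, h2]
      · exact h.restrict_eq_zero_of_not_isSingular hx (hall K) hK
    rwa [Module.finrank_fintype_fun_eq_card, ← Nat.card_eq_fintype_card,
      Nat.card_coe_set_eq] at this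
  have h2 := Submodule.finrank_lt_finrank_of_lt hlt
  have h3 := card_le_finrank_add_finrank_ker T
  omega

/-- Beyond the dimension of `W`, the excess is at most `1`, for imposing sum zero, plus the
multiplicity of `lam` on the only component not dominated by it. -/
theorem IsGramRealization.card_le_of_no_isSingular (hT : IsGramRealization A lam α T)
    (hα : 0 < α) (hlam : 0 < lam) (hw : w ≤ lam) (h : IsWeightedAdjacency G A w) {Δ : ℕ}
    (hΔ : ∀ v, {u | G.Adj v u}.ncard ≤ Δ)
    (hr : ∀ K : G.ConnectedComponent, ¬ K.IsSingular A lam) (j m : ℕ) :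
    (Fintype.card V : ℝ) ≤ Module.finrank ℝ W + 1 +
      ((Δ + 1) ^ (2 * (2 * (j + 1) * (m + 1) + 1) + 1) + (Fintype.card V / (j + 2) + 1) +
      Fintype.card V * (1 - ((w / lam) ^ (2 * (j + 1))) ^ 2) ^ (m + 1)) := by
  classical
  have hpos : 0 ≤ (1 - ((w / lam) ^ (2 * (j + 1))) ^ 2) := by
    rw [← pow_mul]
    exact sub_nonneg.mpr
      (pow_le_one₀ (div_nonneg h.pos.le hlam.le) ((div_le_one hlam).mpr hw))
  have hcard := card_le_finrank_add_finrank_ker T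
  by_cases hall : ∀ K : G.ConnectedComponent, K.IsNonneg A lam
  · have hbot : LinearMap.ker T = ⊥ := by
      rw [eq_bot_iff]
      intro x hx
      refine SimpleGraph.ConnectedComponent.eq_zero_of_forall_restrict (G := G) fun K => ?_
      exact h.restrict_eq_zero_of_not_isSingular (hT.eigen_of_isNonneg hα h hall hx) (hall K) (hr K)
    rw [hbot, finrank_bot, add_zero] at hcard
    have h1 : (Fintype.card V : ℝ) ≤ Module.finrank ℝ W := by exact_mod_cast hcard
    refine h1.trans ?_
    have : 0 ≤ (1 : ℝ) +
      ((Δ + 1) ^ (2 * (2 * (j + 1) * (m + 1) + 1) + 1) + (Fintype.card V / (j + 2) + 1) +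
      Fintype.card V * (1 - ((w / lam) ^ (2 * (j + 1))) ^ 2) ^ (m + 1)) := by positivity
    linarith
  · simp only [not_forall] at hall
    obtain ⟨K, hK⟩ := hall
    obtain ⟨y, hyK, hy⟩ : ∃ y : V → ℝ, K.Supports y ∧ lam * (y ⬝ᵥ y) < y ⬝ᵥ A *ᵥ y := by
      simpa [SimpleGraph.ConnectedComponent.IsNonneg] using hK
    have hother : ∀ K' : G.ConnectedComponent, K ≠ K' → K'.IsNonneg A lam := by
      intro K' hne z hz
      by_contra! hc
      refine h.false_of_separated (fun x hx => hT.dotProduct_mulVec_le hx)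
        (hyK.separated hz hne) hy hc.le ?_
      rintro rfl
      simp at hc
    let σ : (V → ℝ) →ₗ[ℝ] ℝ := ∑ v, LinearMap.proj v
    have hσ : ∀ x : V → ℝ, σ x = ∑ v, x v := fun x => by simp [σ]
    have h1 := finrank_le_add_finrank_inf_ker (LinearMap.ker T) σ
    rw [Module.finrank_self] at h1
    set E := LinearMap.ker T ⊓ LinearMap.ker σ
    -- For `T x = 0` with sum zero, the Gram identity paired with `A x - lam x` reads `|A x - lam
    -- x|² = 0`.
    have hE : ∀ x ∈ E, A *ᵥ x = lam • x := by
      rintro x ⟨hx, hxσ⟩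
      have h2 := hT (A *ᵥ x - lam • x) x
      have h3 : ∑ v, x v = 0 := by rw [← hσ]; exact hxσ
      rw [LinearMap.mem_ker.mp hx, inner_zero_right, h3, mul_zero, mul_zero, add_zero] at h2
      have h4 : (A *ᵥ x - lam • x) ⬝ᵥ (A *ᵥ x - lam • x) = 0 := by
        rw [dotProduct_sub, dotProduct_smul, smul_eq_mul]
        linarith
      exact sub_eq_zero.mp (dotProduct_self_eq_zero.mp h4)
    have hEK : ∀ x ∈ E, K.Supports x := by
      intro x hx v hv
      have h2 := h.restrict_eq_zero_of_not_isSingular (hE x hx) (hother _ (Ne.symm hv)) (hr _)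
      rw [← SimpleGraph.ConnectedComponent.restrict_mk_apply (G := G) x v, h2]
      rfl
    let e : K → V := Subtype.val
    have he : Function.Injective e := Subtype.val_injective
    have hrange : ∀ x ∈ E, Function.extend e (x ∘ e) 0 = x := by
      intro x hx
      refine Matrix.extend_comp_of_forall_notMem_range he fun v hv => hEK x hx v fun hv' => hv ?_
      exact ⟨⟨v, hv'⟩, rfl⟩
    let B := A.submatrix e e
    let g : E →ₗ[ℝ] B.eigenSubmodule lam :=
      LinearMap.codRestrict _ (LinearMap.funLeft ℝ ℝ e ∘ₗ E.subtype) fun x => by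
        rw [Matrix.mem_eigenSubmodule, Matrix.submatrix_mulVec_eq_extend he]
        change (A *ᵥ Function.extend e (x.1 ∘ e) 0) ∘ e = lam • (x.1 ∘ e)
        rw [hrange _ x.2, hE _ x.2]
        rfl
    have hg : Function.Injective g := by
      intro a b hab
      have h2 : a.1 ∘ e = b.1 ∘ e := congrArg Subtype.val hab
      refine Subtype.ext ?_
      rw [← hrange _ a.2, ← hrange _ b.2, h2]
    have h2 := LinearMap.finrank_le_finrank_of_injective hg
    have hB : IsWeightedAdjacency K.toSimpleGraph B w :=
      { isSymm := h.isSymm.submatrix e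
        pos := h.pos
        le_of_adj := fun {u v} huv => h.le_of_adj huv
        eq_zero := fun {u v} huv => h.eq_zero huv }
    have hΔK : ∀ v, {u | K.toSimpleGraph.Adj v u}.ncard ≤ Δ := fun v =>
      (Set.ncard_le_ncard_of_injOn e (fun u hu => hu) he.injOn (Set.toFinite _)).trans (hΔ (e v))
    have hsumK : ∀ z : K → ℝ, ∑ v, z v = 0 → z ⬝ᵥ B *ᵥ z ≤ lam * (z ⬝ᵥ z) := by
      intro z hz
      have hz' : ∑ v, Function.extend e z 0 v = 0 := by
        have := Matrix.extend_dotProduct_extend he z (fun _ => 1)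
        simp only [dotProduct, mul_one, Function.comp_def] at this
        rw [this, hz]
      have h3 := hT.dotProduct_mulVec_le hz'
      rw [Matrix.extend_dotProduct_extend he, Matrix.extend_dotProduct_extend he,
        ← Matrix.submatrix_mulVec_eq_extend he, Function.extend_comp he] at h3
      exact h3
    have h3 := hB.finrank_eigenSubmodule_le hlam hw K.connected_toSimpleGraph hΔK hsumK j m
    have h4 : (Fintype.card K : ℝ) ≤ Fintype.card V := by
      exact_mod_cast Fintype.card_le_of_injective e he
    have h5 : (Fintype.card V : ℝ) ≤
        Module.finrank ℝ W + 1 + Module.finrank ℝ (B.eigenSubmodule lam) := by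
      have : Fintype.card V ≤ Module.finrank ℝ W + 1 + Module.finrank ℝ (B.eigenSubmodule lam) := by
        omega
      exact_mod_cast this
    refine h5.trans (add_le_add_right (h3.trans ?_) _)
    gcongr

end Components

/-! ### From spherical codes to weighted graphs -/

section SphericalCode

open scoped Matrix

variable {α β : ℝ} {L : Set ℝ} {d : ℕ} {C : Finset (EuclideanSpace ℝ (Fin d))}

/-- The weighted adjacency matrix `(1 - α) I - (M_C - α J)` of the negative graph of `C`. -/
noncomputable def codeAdjacency (α : ℝ) (C : Finset (EuclideanSpace ℝ (Fin d))) : Matrix C C ℝ :=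
  open Classical in (1 - α) • (1 : Matrix C C ℝ) - shiftedGram α C

theorem shiftedGram_apply (u v : C) :
    shiftedGram α C u v = inner ℝ (u : EuclideanSpace ℝ (Fin d)) v - α := by
  simp [shiftedGram, Matrix.gram_apply]

theorem codeAdjacency_mulVec (x : C → ℝ) :
    codeAdjacency α C *ᵥ x = (1 - α) • x - shiftedGram α C *ᵥ x := by
  classical
  rw [codeAdjacency, Matrix.sub_mulVec, Matrix.smul_mulVec, Matrix.one_mulVec]

/-- Edge weights are `α - ⟨u, v⟩ ≥ α + β`. The minimum with `1 - α` is taken only to secure `w ≤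
lam`, as the multiplicity bound requires. -/
theorem IsSphericalCode.isWeightedAdjacency (hC : IsSphericalCode L C) (hα : 0 < α) (hβ : 0 < β)
    (hα1 : α < 1) (hL : L ⊆ Set.Icc (-1) (-β) ∪ {α}) :
    IsWeightedAdjacency (negGraph C) (codeAdjacency α C) (min (α + β) (1 - α)) where
  isSymm := by
    refine Matrix.IsSymm.ext fun u v => ?_
    simp only [codeAdjacency, Matrix.sub_apply, Matrix.smul_apply, shiftedGram_apply,
      Matrix.one_apply, real_inner_comm, eq_comm]
  pos := lt_min (by linarith) (by linarith)
  le_of_adj {u v} huv := by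
    have h1 := hC.2 u u.2 v v.2 fun h => huv.1 (Subtype.ext h)
    simp only [codeAdjacency, Matrix.sub_apply, Matrix.smul_apply, shiftedGram_apply,
      Matrix.one_apply_ne huv.1, smul_zero]
    rcases hL h1 with h2 | h2
    · refine (min_le_left _ _).trans ?_
      linarith [h2.2]
    · rw [Set.mem_singleton_iff] at h2
      exact absurd huv.2 (by rw [h2]; exact not_lt.mpr hα.le)
  eq_zero {u v} huv := by
    by_cases h : u = v
    · subst h
      simp [codeAdjacency, shiftedGram_apply, hC.1 u u.2]
    · have h1 := hC.2 u u.2 v v.2 fun h' => h (Subtype.ext h')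
      have h2 : ¬ inner ℝ (u : EuclideanSpace ℝ (Fin d)) v < 0 := fun h' => huv ⟨h, h'⟩
      simp only [codeAdjacency, Matrix.sub_apply, Matrix.smul_apply, shiftedGram_apply,
        Matrix.one_apply_ne h, smul_zero]
      rcases hL h1 with h3 | h3
      · exact absurd (h3.2.trans_lt (by linarith)) h2
      · rw [Set.mem_singleton_iff] at h3
        rw [h3]
        ring

/-- The linear map sending coefficients to the corresponding combination of code vectors. -/
noncomputable def codeCombination (C : Finset (EuclideanSpace ℝ (Fin d))) :
    (C → ℝ) →ₗ[ℝ] EuclideanSpace ℝ (Fin d) :=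
  Fintype.linearCombination ℝ (fun v : C => (v : EuclideanSpace ℝ (Fin d)))

theorem isGramRealization_codeCombination (α : ℝ) (C : Finset (EuclideanSpace ℝ (Fin d))) :
    IsGramRealization (codeAdjacency α C) (1 - α) α (codeCombination C) := by
  intro x y
  have h1 : inner ℝ (codeCombination C x) (codeCombination C y) =
      ∑ u : C, ∑ v : C, x u * (inner ℝ (u : EuclideanSpace ℝ (Fin d)) v * y v) := by
    simp only [codeCombination, Fintype.linearCombination_apply, sum_inner, inner_sum,
      real_inner_smul_left, real_inner_smul_right]
    rw [Finset.sum_comm]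
    refine Finset.sum_congr rfl fun u _ => Finset.sum_congr rfl fun v _ => ?_
    ring
  have h2 : x ⬝ᵥ shiftedGram α C *ᵥ y =
      ∑ u : C, ∑ v : C, x u * (inner ℝ (u : EuclideanSpace ℝ (Fin d)) v * y v) -
        α * ((∑ v, x v) * ∑ v, y v) := by
    rw [Finset.sum_mul_sum, Finset.mul_sum, ← Finset.sum_sub_distrib]
    simp only [dotProduct, Matrix.mulVec, shiftedGram_apply, Finset.mul_sum]
    refine Finset.sum_congr rfl fun u _ => ?_
    rw [← Finset.sum_sub_distrib]
    refine Finset.sum_congr rfl fun v _ => ?_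
    ring
  rw [codeAdjacency_mulVec, dotProduct_sub, dotProduct_smul, smul_eq_mul, h2, h1]
  ring

theorem mem_componentVectors {K : (negGraph C).ConnectedComponent} {v : C} :
    (v : EuclideanSpace ℝ (Fin d)) ∈ componentVectors C K ↔
      (negGraph C).connectedComponentMk v = K := by
  simp [componentVectors]

theorem componentVectors_subset (K : (negGraph C).ConnectedComponent) :
    componentVectors C K ⊆ C := by
  intro v hv
  simp only [componentVectors, Finset.mem_filter] at hv
  exact hv.1

/-- The shifted Gram matrix of a component is a principal submatrix. Extension by zero carries its
null vectors to eigenvectors of the full matrix, because `A` does not mix components. -/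
theorem isAlphaSingular_componentVectors_iff (hC : IsSphericalCode L C) {w : ℝ}
    (h : IsWeightedAdjacency (negGraph C) (codeAdjacency α C) w)
    (K : (negGraph C).ConnectedComponent) :
    IsAlphaSingular L α (componentVectors C K) ↔ K.IsSingular (codeAdjacency α C) (1 - α) := by
  classical
  let e : componentVectors C K → C := fun v => ⟨v, componentVectors_subset K v.2⟩
  have he : Function.Injective e := fun a b hab =>
    Subtype.ext (congrArg (fun c : C => (c : EuclideanSpace ℝ (Fin d))) hab)
  have hN : shiftedGram α (componentVectors C K) = (shiftedGram α C).submatrix e e := rfl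
  have hcode : IsSphericalCode L (componentVectors C K) :=
    ⟨fun v hv => hC.1 v (componentVectors_subset K hv), fun u hu v hv huv =>
      hC.2 u (componentVectors_subset K hu) v (componentVectors_subset K hv) huv⟩
  have hherm : (shiftedGram α (componentVectors C K)).IsHermitian := by
    ext u v
    simp [shiftedGram_apply, real_inner_comm]
  have hsupp : ∀ z : componentVectors C K → ℝ, K.Supports (Function.extend e z 0) := by
    intro z v hv
    refine Function.extend_apply' _ _ _ ?_
    rintro ⟨i, rfl⟩
    exact hv (mem_componentVectors.mp i.2)
  have hext : ∀ x : C → ℝ, K.Supports x → Function.extend e (x ∘ e) 0 = x := by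
    intro x hx
    refine Matrix.extend_comp_of_forall_notMem_range he fun v hv => hx v fun hv' => hv ?_
    exact ⟨⟨v, mem_componentVectors.mpr hv'⟩, rfl⟩
  have hform : ∀ z : componentVectors C K → ℝ,
      z ⬝ᵥ shiftedGram α (componentVectors C K) *ᵥ z =
      (1 - α) * (Function.extend e z 0 ⬝ᵥ Function.extend e z 0) -
        Function.extend e z 0 ⬝ᵥ codeAdjacency α C *ᵥ Function.extend e z 0 := by
    intro z
    rw [hN, Matrix.submatrix_mulVec_eq_extend he, ← Matrix.extend_dotProduct_extend he,
      codeAdjacency_mulVec, dotProduct_sub, dotProduct_smul, smul_eq_mul]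
    ring
  have hpsd : (shiftedGram α (componentVectors C K)).PosSemidef ↔
      K.IsNonneg (codeAdjacency α C) (1 - α) := by
    constructor
    · intro hp x hx
      have h1 := hp.dotProduct_mulVec_nonneg (x ∘ e)
      rw [star_trivial, hform, hext x hx] at h1
      linarith
    · intro hp
      refine Matrix.PosSemidef.of_dotProduct_mulVec_nonneg hherm fun z => ?_
      rw [star_trivial, hform]
      exact sub_nonneg.mpr (hp _ (hsupp z))
  have hdet : (shiftedGram α (componentVectors C K)).det = 0 ↔
      ∃ x : C → ℝ, x ≠ 0 ∧ K.Supports x ∧ codeAdjacency α C *ᵥ x = (1 - α) • x := by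
    rw [← Matrix.exists_mulVec_eq_zero_iff]
    constructor
    · rintro ⟨z, hz, hz0⟩
      refine ⟨Function.extend e z 0, fun h0 => hz ?_, hsupp z, ?_⟩
      · rw [← Function.extend_comp he z 0, h0]
        rfl
      · rw [hN, Matrix.submatrix_mulVec_eq_extend he] at hz0
        have hK : K.restrict (Function.extend e z 0) = Function.extend e z 0 := by
          ext v
          by_cases hv : (negGraph C).connectedComponentMk v = K
          · simp [SimpleGraph.ConnectedComponent.restrict, hv]
          · rw [K.supports_restrict _ v hv, hsupp z v hv]
        ext v
        by_cases hv : (negGraph C).connectedComponentMk v = K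
        · have h1 := congrFun hz0 ⟨v, mem_componentVectors.mpr hv⟩
          rw [codeAdjacency_mulVec, Pi.sub_apply]
          have h2 : (shiftedGram α C *ᵥ Function.extend e z 0) v = 0 := h1
          rw [h2, sub_zero]
        · rw [← hK, h.mulVec_restrict, K.supports_restrict _ v hv, Pi.smul_apply,
            K.supports_restrict _ v hv, smul_zero]
    · rintro ⟨x, hx, hxK, hAx⟩
      refine ⟨x ∘ e, fun h0 => hx ?_, ?_⟩
      · rw [← hext x hxK, h0]
        ext v
        by_cases hv : ∃ i, e i = v
        · obtain ⟨i, rfl⟩ := hv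
          rw [he.extend_apply]; rfl
        · rw [Function.extend_apply' _ _ _ hv]
      · rw [hN, Matrix.submatrix_mulVec_eq_extend he, hext x hxK]
        rw [codeAdjacency_mulVec, sub_eq_self] at hAx
        rw [hAx]
        rfl
  constructor
  · rintro ⟨-, hp, hd⟩
    refine ⟨hpsd.mp hp, hdet.mp ?_⟩
    convert hd
  · rintro ⟨hp, hx⟩
    refine ⟨hcode, hpsd.mpr hp, ?_⟩
    convert hdet.mpr hx

theorem ncard_negGraph_adj_le {Δ : ℕ} (h : maxNegDegree C ≤ Δ) (v : C) :
    {u | (negGraph C).Adj v u}.ncard ≤ Δ := by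
  classical
  refine le_trans ?_ h
  rw [maxNegDegree]
  refine le_trans (le_of_eq ?_) ((negGraph C).degree_le_maxDegree v)
  rw [← SimpleGraph.card_neighborSet_eq_degree, ← Nat.card_eq_fintype_card, Nat.card_coe_set_eq]
  rfl

end SphericalCode

theorem mainTheorem5 (α β : ℝ) (hα : α ∈ Set.Ioo (0 : ℝ) 1) (hβ : β ∈ Set.Ioo (0 : ℝ) 1)
    (L : Set ℝ) (hL : L ⊆ Set.Icc (-1) (-β) ∪ {α}) (hαL : α ∈ L) (Δ : ℕ) :
    ∃ K : ℝ, ∀ (d : ℕ) (V : Finset (EuclideanSpace ℝ (Fin d))) (r : ℕ),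
      IsSphericalCode L V → maxNegDegree V ≤ Δ → numSingularComponents L α V = r →
        (r ≠ 0 → (V.card : ℝ) ≤ d + r - 1) ∧
        (r = 0 → 3 ≤ d → (V.card : ℝ) ≤ d + K * (d / Real.log (Real.log d))) := by
  have hlam : 0 < 1 - α := sub_pos.mpr hα.2
  have hw0 : 0 < min (α + β) (1 - α) := lt_min (add_pos hα.1 hβ.1) hlam
  have hw : min (α + β) (1 - α) ≤ 1 - α := min_le_right _ _
  obtain ⟨a, ha, hbound⟩ := exists_exp_exp_bound hw0 hw Δ
  obtain ⟨K, hK⟩ := exists_const_le_add_div_log_log ha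
  refine ⟨K, fun d V r hV hΔ hr => ?_⟩
  have hA := hV.isWeightedAdjacency hα.1 hβ.1 hα.2 hL
  have hT := isGramRealization_codeCombination α V
  have hcard : Fintype.card V = V.card := Fintype.card_coe V
  have hset : {K : (negGraph V).ConnectedComponent | K.IsSingular (codeAdjacency α V) (1 - α)}
      = {K | IsAlphaSingular L α (componentVectors V K)} := by
    ext K
    exact (isAlphaSingular_componentVectors_iff hV hA K).symm
  have hncard : {K : (negGraph V).ConnectedComponent |
      K.IsSingular (codeAdjacency α V) (1 - α)}.ncard = r := by
    rw [hset]
    exact hr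
  constructor
  · intro hr0
    have h1 := hT.card_lt_finrank_add_ncard hα.1 hA (by rwa [hncard])
    rw [hncard, finrank_euclideanSpace_fin, hcard] at h1
    have h2 : (V.card : ℝ) + 1 ≤ d + r := by exact_mod_cast h1
    linarith
  · rintro rfl hd
    rw [Set.ncard_eq_zero] at hncard
    refine hK d V.card hd fun j => ?_
    obtain ⟨m, hm1, hm2⟩ := hbound j
    have h1 := hT.card_le_of_no_isSingular hα.1 hlam hw hA (ncard_negGraph_adj_le hΔ)
      (fun K hs => (Set.eq_empty_iff_forall_notMem.mp hncard K) hs) j m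
    rw [finrank_euclideanSpace_fin, hcard] at h1
    -- The decay term is at most the net term `|V| / (j + 2)`, whence the factor `2` in the growth
    -- bound.
    have h2 := mul_le_mul_of_nonneg_left hm2 (Nat.cast_nonneg (α := ℝ) V.card)
    rw [mul_one_div] at h2
    linarith
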